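/- **Theorem (Reduced Multi-Orbit Skew Spectrum).** Let $n \ge 4$, $d \ge 1$, let $\mathbb S_{n-2}\le\mathbb S_n$ be the subgroup fixing $n-1$ and $n$, and let $f=(f_1,\dots,f_d):\mathbb S_n/\mathbb S_{n-2}\to\mathbb C^d$ (regarded also as a function on $\mathbb S_n$ that is invariant under right translation by $\mathbb S_{n-2}$). For a partition $\lambda$ of $n$ let $\rho_\lambda$ be Young's orthogonal representation, whose rows and columns are indexed by the standard Young tableaux of shape $\lambda$; let $\Lambda_n=\{(n),(n-1,1),(n-2,2),(n-2,1,1)\}$ and $$\tau(\rho)=\frac1{|\mathbb S_{n-2}|}\sum_{h\in\mathbb S_{n-2}}\rho(h),\qquad \hat u(\rho)=\frac1{n!}\sum_{g\in\mathbb S_n}u(g)\rho(g).$$ The reduced Multi-Orbit Skew Spectrum of $f$ is the family of matrices $$\hat{\mathcal S}_f(g_1,\rho)_{i_1,i_2,i_3}=\sum_{g,g_2\in\mathbb S_n}\frac{f_{i_1}(g)\,f_{i_2}(gg_1)\,f_{i_3}(g_2)}{(n!)^2}\;\tau(\rho)^\dagger\rho(g)^\dagger\rho(g_2),\qquad (i_1,i_2,i_3)\in[d]^3,\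 \rho=\rho_\lambda,\ \lambda\in\Lambda_n,$$ where $g_1$ runs over the seven double coset representatives $(),\,(n-1,n),\,(n-2,n-1),\,(n-2,n),\,(n-2,n-1,n),\,(n-2,n,n-1),\,(n-3,n-1)(n-2,n)$ of $\mathbb S_{n-2}\backslash\mathbb S_n/\mathbb S_{n-2}$. 1. *(Running time.)* The spectrum can be computed in $O(d^2n^3+d^3n^2)$ operations. That is, there are one program for a random access machine over $\mathbb C$ and an absolute constant $C$ such that for all $n\ge4$, $d\ge1$ and $f$, the program, started with $n$, $d$ and the table of the $d\,n(n-1)$ values of $f$, makes at most $C(d^2n^3+d^3n^2)$ steps and writes, at fixed addresses, all entries of the spectrum whose row and column are tableaux with $1,\dots,n-2$ in the first row; all other entries of the spectrum are zero for every $f$. Steps are the operations $+,-,\times,\div$ and complex conjugation, square roots of natural numbers (for the constants of Young's orthogonal form), natural-number arithmetic on indices, comparisons of indices, memory accesses and loop passes. 2. *(Sparsity.)* The spectrum of $f$ has at most $49\,d^3$ non-zero scalar entries in total, over all $g_1$, $(i_1,i_2,i_3)$, $\lambda$, rows and columns. Both parts also hold for the variant $\hat{\mathcal S}_f(g_1,\rho)_{i_1,i_2,i_3}=\bigl(\hat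 r_{i_1,i_2}(g_1,\rho)\,\tau(\rho)\bigr)^\dagger\hat f_{i_3}(\rho)$ with $\hat r_{i_1,i_2}(g_1,\rho)=\frac1{n!}\sum_{g}f_{i_1}(g)f_{i_2}(gg_1)\rho(g)$, in which the first two factors are complex conjugated (for real-valued $f$ the two coincide). -/

import Mathlib

noncomputable section

namespace SkewSpectrum

open Equiv Matrix

/-! ### The symmetric group, the subgroup fixing the last two points, the seven representatives

The letters `1, …, n` of the mathematics are the elements `0, …, n - 1` of `Fin n`. -/

/-- The copy of the symmetric group on `n - 2` letters inside `Perm (Fin n)`: the permutations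
that fix the last two letters. -/
abbrev lastTwoStab (n : ℕ) : Subgroup (Perm (Fin n)) :=
  fixingSubgroup (Perm (Fin n)) {k : Fin n | n ≤ (k : ℕ) + 2}

/-- The last four letters: `pt hn 0, pt hn 1, pt hn 2, pt hn 3` stand for
`n - 3, n - 2, n - 1, n` in one-based numbering. -/
def pt {n : ℕ} (hn : 4 ≤ n) (j : Fin 4) : Fin n := ⟨n - 4 + j, by omega⟩

/-- The seven representatives
`(), (n-1,n), (n-2,n-1), (n-2,n), (n-2,n-1,n), (n-2,n,n-1), (n-3,n-1)(n-2,n)`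
of the double cosets of `lastTwoStab n`. `List.formPerm [x, y, z]` is the cycle `x ↦ y ↦ z ↦ x`. -/
def transversal {n : ℕ} (hn : 4 ≤ n) : Fin 7 → Perm (Fin n) :=
  ![1,
    swap (pt hn 2) (pt hn 3),
    swap (pt hn 1) (pt hn 2),
    swap (pt hn 1) (pt hn 3),
    List.formPerm [pt hn 1, pt hn 2, pt hn 3],
    List.formPerm [pt hn 1, pt hn 3, pt hn 2],
    swap (pt hn 0) (pt hn 2) * swap (pt hn 1) (pt hn 3)]

/-! ### Young's orthogonal representation -/

/-- Standard Young tableaux of shape `μ` with entries `0, …, n - 1`: the tableau sends a letter to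
the cell `(row, column)` that contains it; entries increase along rows and along columns.
(The type is empty unless `μ` has `n` cells.) -/
def StdTableau (μ : YoungDiagram) (n : ℕ) : Type :=
  {e : Fin n ≃ μ.cells //
    (∀ a b, (e a).1.1 = (e b).1.1 → (e a).1.2 < (e b).1.2 → a < b) ∧
    (∀ a b, (e a).1.2 = (e b).1.2 → (e a).1.1 < (e b).1.1 → a < b)}

instance (μ : YoungDiagram) (n : ℕ) : Finite (StdTableau μ n) :=
  inferInstanceAs (Finite {e : Fin n ≃ μ.cells //
    (∀ a b, (e a).1.1 = (e b).1.1 → (e a).1.2 < (e b).1.2 → a < b) ∧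
    (∀ a b, (e a).1.2 = (e b).1.2 → (e a).1.1 < (e b).1.1 → a < b)})

instance (μ : YoungDiagram) (n : ℕ) : Fintype (StdTableau μ n) := Fintype.ofFinite _

instance (μ : YoungDiagram) (n : ℕ) : DecidableEq (StdTableau μ n) := Classical.decEq _

/-- The row (numbered from `0`) of the letter `k` in the tableau. -/
def StdTableau.row {μ : YoungDiagram} {n : ℕ} (T : StdTableau μ n) (k : Fin n) : ℕ := (T.1 k).1.1

/-- The content, column minus row, of the cell of the letter `k`. -/
def StdTableau.content {μ : YoungDiagram} {n : ℕ} (T : StdTableau μ n) (k : Fin n) : ℤ :=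
  ((T.1 k).1.2 : ℤ) - ((T.1 k).1.1 : ℤ)

/-- The letter `i`. -/
def lo {n : ℕ} (i : Fin (n - 1)) : Fin n := ⟨i, by omega⟩

/-- The letter `i + 1`. -/
def hi {n : ℕ} (i : Fin (n - 1)) : Fin n := ⟨i + 1, by omega⟩

/-- The adjacent transposition exchanging `i` and `i + 1`. -/
def adj {n : ℕ} (i : Fin (n - 1)) : Perm (Fin n) := swap (lo i) (hi i)

/-- The matrix of an adjacent transposition in Young's orthogonal form. With `r` the axial distance
`content (i + 1) - content i` in `T`, the column `T` has the diagonal entry `1 / r` and, if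
exchanging `i` and `i + 1` in `T` gives a standard tableau `U`, the entry `√(1 - 1 / r ^ 2)` in
row `U`. -/
def yorAdj (μ : YoungDiagram) {n : ℕ} (i : Fin (n - 1)) :
    Matrix (StdTableau μ n) (StdTableau μ n) ℂ := by
  classical
  exact Matrix.of fun U T =>
    let r : ℝ := ((T.content (hi i) - T.content (lo i) : ℤ) : ℝ)
    if U = T then ((1 / r : ℝ) : ℂ)
    else if ∀ k, U.1 k = T.1 (adj i k) then ((Real.sqrt (1 - 1 / r ^ 2) : ℝ) : ℂ)
    else 0

/-- Every permutation is a product of adjacent transpositions. -/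
theorem exists_word {n : ℕ} (σ : Perm (Fin n)) :
    ∃ w : List (Fin (n - 1)), (w.map adj).prod = σ := by
  cases n with
  | zero => exact ⟨[], Subsingleton.elim _ _⟩
  | succ m =>
    have h : σ ∈ Submonoid.closure
        (Set.range fun i : Fin m => swap i.castSucc i.succ) := by
      rw [Equiv.Perm.mclosure_swap_castSucc_succ]; trivial
    induction h using Submonoid.closure_induction with
    | mem x hx =>
      obtain ⟨i, rfl⟩ := hx
      refine ⟨[i], ?_⟩
      simp only [List.map_cons, List.map_nil, List.prod_cons, List.prod_nil, mul_one]
      rfl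
    | one => exact ⟨[], rfl⟩
    | mul x y _ _ hx hy =>
      obtain ⟨u, hu⟩ := hx
      obtain ⟨v, hv⟩ := hy
      exact ⟨u ++ v, by rw [List.map_append, List.prod_append, hu, hv]⟩

/-- Young's orthogonal representation of shape `μ`: write `σ` as a product of adjacent
transpositions and multiply their matrices. -/
def yor (μ : YoungDiagram) {n : ℕ} (σ : Perm (Fin n)) :
    Matrix (StdTableau μ n) (StdTableau μ n) ℂ :=
  ((exists_word σ).choose.map (yorAdj μ)).prod

/-- The row lengths of the four shapes `(n)`, `(n-1,1)`, `(n-2,2)`, `(n-2,1,1)`. -/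
def rowLens (n : ℕ) : Fin 4 → List ℕ := ![[n], [n - 1, 1], [n - 2, 2], [n - 2, 1, 1]]

theorem rowLens_sorted {n : ℕ} (hn : 4 ≤ n) (k : Fin 4) : (rowLens n k).SortedGE := by
  rw [List.sortedGE_iff_pairwise]
  fin_cases k <;> simp [rowLens] <;> omega

/-- The Young diagrams of the four partitions of `n` in the list `Λ n`. -/
def shape {n : ℕ} (hn : 4 ≤ n) (k : Fin 4) : YoungDiagram :=
  YoungDiagram.ofRowLens (rowLens n k) (rowLens_sorted hn k)

/-! ### The reduced Multi-Orbit Skew Spectrum -/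

/-- The projection onto the trivial representation of the subgroup fixing the last two letters:
the average of `ρ` over that subgroup. -/
def tau {n : ℕ} {ι : Type} (ρ : Perm (Fin n) → Matrix ι ι ℂ) : Matrix ι ι ℂ := by
  classical
  exact (1 / (Nat.card (lastTwoStab n) : ℂ)) • ∑ h with h ∈ lastTwoStab n, ρ h

/-- The Fourier transform of a function on the symmetric group. -/
def fourier {n : ℕ} {ι : Type} (ρ : Perm (Fin n) → Matrix ι ι ℂ) (u : Perm (Fin n) → ℂ) :
    Matrix ι ι ℂ :=
  (1 / (n.factorial : ℂ)) • ∑ g, u g • ρ g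

/-- For complex-valued functions there are two customary readings of the spectrum: without complex
conjugation of the values of the function (`plain`), or as the Fourier-side product
`(r̂ τ)† f̂`, in which the dagger also conjugates the first two function values (`conjugated`).
They agree for real-valued functions. -/
inductive Convention
  | plain
  | conjugated

/-- The entry, for the orbit triple `i`, the group element `g₁` and the representation `ρ`, of the
reduced Multi-Orbit Skew Spectrum of `f : S_n / S_{n-2} → ℂ^d`. -/
def reducedEntry {n d : ℕ} {ι : Type} [Fintype ι] (conv : Convention)
    (f : Perm (Fin n) ⧸ lastTwoStab n → Fin d → ℂ)
    (ρ : Perm (Fin n) → Matrix ι ι ℂ) (g₁ : Perm (Fin n)) (i : Fin 3 → Fin d) : Matrix ι ι ℂ :=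
  match conv with
  | .plain =>
      ∑ g : Perm (Fin n), ∑ g₂ : Perm (Fin n),
        (f g (i 0) * f ↑(g * g₁) (i 1) * f g₂ (i 2) / (n.factorial : ℂ) ^ 2) •
          ((tau ρ)ᴴ * (ρ g)ᴴ * ρ g₂)
  | .conjugated =>
      (fourier ρ (fun g => f g (i 0) * f ↑(g * g₁) (i 1)) * tau ρ)ᴴ *
        fourier ρ (fun g => f g (i 2))

/-- The scalar entries of the reduced Multi-Orbit Skew Spectrum: `a` numbers the seven group
elements, `i` is the orbit triple, `k` numbers the four irreducible representations, and `T`, `U`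
are the row and the column of the matrix. -/
def spectrum {n d : ℕ} (hn : 4 ≤ n) (conv : Convention)
    (f : Perm (Fin n) ⧸ lastTwoStab n → Fin d → ℂ) (a : Fin 7) (i : Fin 3 → Fin d) (k : Fin 4)
    (T U : StdTableau (shape hn k) n) : ℂ :=
  reducedEntry conv f (yor (shape hn k)) (transversal hn a) i T U

/-- The tableaux that restrict to the one-row shape `(n-2)`: all letters but the last two lie in
the first row. -/
def StdTableau.IsActive {μ : YoungDiagram} {n : ℕ} (T : StdTableau μ n) : Prop :=
  ∀ k : Fin n, (k : ℕ) + 2 < n → T.row k = 0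

/-! ### Programs and their running time

A uniform random access machine over `ℂ`, with structured programs. A program is one finite text,
used for all `n` and `d`. It works on finitely many multi-dimensional arrays of complex numbers.
Every step is charged: arithmetic on complex numbers, arithmetic on indices, reading and writing of
cells, comparisons of indices, and the passes of loops. -/

/-- Natural-number expressions in the loop variables; variables `0` and `1` initially hold
`n` and `d`. -/
inductive NatExp
  | lit (c : ℕ)
  | var (x : ℕ)
  | add (a b : NatExp)
  | sub (a b : NatExp)
  | mul (a b : NatExp)

/-- Values of index expressions; subtraction is truncated. -/
def NatExp.eval (env : ℕ → ℕ) : NatExp → ℕ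
  | lit c => c
  | var x => env x
  | add a b => a.eval env + b.eval env
  | sub a b => a.eval env - b.eval env
  | mul a b => a.eval env * b.eval env

/-- The number of steps for an index expression: its number of nodes. -/
def NatExp.cost : NatExp → ℕ
  | lit _ => 1
  | var _ => 1
  | add a b => a.cost + b.cost + 1
  | sub a b => a.cost + b.cost + 1
  | mul a b => a.cost + b.cost + 1

/-- Memory: the complex number in the cell with the given list of indices of the given array. -/
abbrev Memory := ℕ → List ℕ → ℂ

/-- Complex expressions. Square roots can be taken of natural-number expressions only, never of
data; they provide the irrational constants of Young's orthogonal form. -/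
inductive ComplexExp
  | ofNat (a : NatExp)
  | sqrtNat (a : NatExp)
  | get (arr : ℕ) (idx : List NatExp)
  | add (x y : ComplexExp)
  | sub (x y : ComplexExp)
  | mul (x y : ComplexExp)
  | div (x y : ComplexExp)
  | conj (x : ComplexExp)

/-- Values of complex expressions. -/
def ComplexExp.eval (env : ℕ → ℕ) (M : Memory) : ComplexExp → ℂ
  | ofNat a => (a.eval env : ℂ)
  | sqrtNat a => ((Real.sqrt (a.eval env : ℝ) : ℝ) : ℂ)
  | get arr idx => M arr (idx.map (NatExp.eval env))
  | add x y => x.eval env M + y.eval env M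
  | sub x y => x.eval env M - y.eval env M
  | mul x y => x.eval env M * y.eval env M
  | div x y => x.eval env M / y.eval env M
  | conj x => star (x.eval env M)

/-- The number of steps for a complex expression: one for each operation and each memory access,
plus the steps for the index expressions in it. -/
def ComplexExp.cost : ComplexExp → ℕ
  | ofNat a => a.cost + 1
  | sqrtNat a => a.cost + 1
  | get _ idx => (idx.map NatExp.cost).sum + 1
  | add x y => x.cost + y.cost + 1
  | sub x y => x.cost + y.cost + 1
  | mul x y => x.cost + y.cost + 1
  | div x y => x.cost + y.cost + 1
  | conj x => x.cost + 1

/-- Programs: assignment to a cell, sequence, branching on `a ≤ b`, and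
`for x = 0, …, bound - 1 do body`. -/
inductive Prog
  | skip
  | set (arr : ℕ) (idx : List NatExp) (e : ComplexExp)
  | seq (p q : Prog)
  | ifLE (a b : NatExp) (p q : Prog)
  | forLoop (x : ℕ) (bound : NatExp) (body : Prog)

/-- Running a program: the final memory and the number of steps. Loop variables are local to the
loop, and the bound of a loop is evaluated once, on entry. -/
def Prog.run : Prog → (ℕ → ℕ) → Memory → Memory × ℕ
  | skip, _, M => (M, 1)
  | set arr idx e, env, M =>
      (Function.update M arr
        (Function.update (M arr) (idx.map (NatExp.eval env)) (e.eval env M)),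
        (idx.map NatExp.cost).sum + e.cost + 1)
  | seq p q, env, M =>
      ((q.run env (p.run env M).1).1, (p.run env M).2 + (q.run env (p.run env M).1).2)
  | ifLE a b p q, env, M =>
      if a.eval env ≤ b.eval env then
        ((p.run env M).1, a.cost + b.cost + 1 + (p.run env M).2)
      else
        ((q.run env M).1, a.cost + b.cost + 1 + (q.run env M).2)
  | forLoop x bound body, env, M =>
      Nat.rec (motive := fun _ => Memory × ℕ) (M, bound.cost + 1)
        (fun j s =>
          ((body.run (Function.update env x j) s.1).1,
            s.2 + 1 + (body.run (Function.update env x j) s.1).2))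
        (bound.eval env)

/-- The initial values of the variables: `n` in variable `0` and `d` in variable `1`. -/
def initEnv (n d : ℕ) : ℕ → ℕ := fun x => if x = 0 then n else if x = 1 then d else 0

/-- The memory holds the table of the values of `f` in array `0`: the value `f_i(σ)` stands in the
cell `[i, σ(n-1), σ(n)]` (one-based letters). All other cells are arbitrary. -/
def HoldsInput {n d : ℕ} (hn : 4 ≤ n) (f : Perm (Fin n) ⧸ lastTwoStab n → Fin d → ℂ)
    (M : Memory) : Prop :=
  ∀ (σ : Perm (Fin n)) (i : Fin d),
    M 0 [(i : ℕ), (σ (pt hn 2) : ℕ), (σ (pt hn 3) : ℕ)] = f σ i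

/-- The output cell, in array `1`, of a scalar entry of the spectrum. A row or column `T` is named
by the rows of the last two letters in `T`, which determine `T` if it is active. -/
def outputCell {n d : ℕ} (hn : 4 ≤ n) (a : Fin 7) (i : Fin 3 → Fin d) (k : Fin 4)
    (T U : StdTableau (shape hn k) n) : List ℕ :=
  [(a : ℕ), (k : ℕ), T.row (pt hn 2), T.row (pt hn 3), U.row (pt hn 2), U.row (pt hn 3),
    (i 0 : ℕ), (i 1 : ℕ), (i 2 : ℕ)]

end SkewSpectrum

end

noncomputable section

namespace SkewSpectrum

open Equiv Matrix

/-! ### The Coxeter presentation of the symmetric group -/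

/-! A function on the cosets of `lastTwoStab n` is a function of the ordered pair of distinct
letters to which a permutation sends the last two letters, and the seven double cosets are the seven
relative positions `pairType` of two such pairs. Everything is reduced to sums over pairs.

The average `tau` is the diagonal projection onto the active tableaux (`tau_eq_diagonal`). It stands
on the left of each spectrum matrix, and right invariance of the third factor puts it on the right
as well. So entries outside active rows and columns vanish, and between active tableaux a matrix
entry of the representation depends only on the double coset (`yor_apply_eq_of_pairType`). The sum
over `g₂` therefore collapses to seven sums of `f` over the pairs of one type, and the translate by
`g₁` may be replaced by its average over a type (`sum_mul_translate`). What remains is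
`pairFormula`, a single sum over pairs of letters.

The seven values of the representation follow from the Jucys–Murphy elements: these act on tableaux
by contents, and the sum of the representation over coset representatives of a double coset, seen
between active tableaux, is a polynomial in the last two of them and the last adjacent transposition
(`typeCard_mul_yor_apply`). This needs Young's matrices to form a representation, hence the Coxeter
presentation (`prod_eq_of_coxeter`).

By inclusion–exclusion (`typeSum_eq`) a type sum is a bounded expression in row sums, column sums
and the total of the table of `f`, which are tabulated in `O(d n ^ 2)` steps. Each summand of
`pairFormula` then has constant cost and each entry costs `O(n ^ 2)`. The four shapes have `1, 2, 1,
1` active tableaux, hence `1 + 4 + 1 + 1 = 7` pairs of row and column. With seven group elements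
there are at most `49 d ^ 3` non-zero entries, and the total cost is `O(d ^ 3 n ^ 2)`, which is
within the claimed bound. -/

/-- The product `x k * x (k - 1) * ⋯` of `t` factors with descending indices. -/
def descProd {G : Type*} [Monoid G] (x : ℕ → G) (k : ℕ) : ℕ → G
  | 0 => 1
  | t + 1 => descProd x k t * x (k - t)

section Coxeter

variable {G : Type*} [Monoid G] {x : ℕ → G} {N : ℕ}

theorem descProd_mul_of_far (hfar : ∀ i j, i + 2 ≤ j → j < N → x i * x j = x j * x i)
    {k i : ℕ} (hk : k < N) : ∀ t, i + t < k → descProd x k t * x i = x i * descProd x k t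
  | 0, _ => by simp [descProd]
  | t + 1, h => by
    rw [descProd, mul_assoc, ← hfar i (k - t) (by omega) (by omega), ← mul_assoc,
      descProd_mul_of_far hfar hk t (by omega), mul_assoc]

/-- The generator commutes leftwards past the low factors until it meets its own index; there one
braid move lowers its index by one, and the lowered generator commutes past the remaining high
factors. -/
theorem descProd_mul_of_braid (hfar : ∀ i j, i + 2 ≤ j → j < N → x i * x j = x j * x i)
    (hbraid : ∀ i, i + 1 < N → x i * x (i + 1) * x i = x (i + 1) * x i * x (i + 1))
    {k i : ℕ} (hk : k < N) (hik : i + 1 ≤ k) :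
    ∀ t, t ≤ k + 1 → k + 1 ≤ i + t → descProd x k t * x (i + 1) = x i * descProd x k t
  | 0, _, h => by omega
  | t + 1, ht, h => by
    rcases Nat.lt_or_ge k (i + t) with h' | h'
    · rw [descProd, mul_assoc, hfar (k - t) (i + 1) (by omega) (by omega), ← mul_assoc,
        descProd_mul_of_braid hfar hbraid hk hik t (by omega) (by omega), mul_assoc]
    · obtain ⟨u, rfl⟩ : ∃ u, t = u + 1 := ⟨t - 1, by omega⟩
      have h1 : k - (u + 1) = i := by omega
      have h2 : k - u = i + 1 := by omega
      have h3 := descProd_mul_of_far hfar hk (i := i) u (by omega)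
      simp only [descProd, h1, h2]
      calc descProd x k u * x (i + 1) * x i * x (i + 1)
          = descProd x k u * (x (i + 1) * x i * x (i + 1)) := by simp only [mul_assoc]
        _ = descProd x k u * x i * (x (i + 1) * x i) := by
          rw [← hbraid i (by omega)]; simp only [mul_assoc]
        _ = _ := by rw [h3]; simp only [mul_assoc]

/-- The submonoid generated by the first `k` elements of a sequence. -/
def initialClosure (x : ℕ → G) (k : ℕ) : Submonoid G := Submonoid.closure {g | ∃ i < k, x i = g}

/-- The normal form of words in Coxeter generators. Such a form is stable under right multiplication
by `x i`: according to the size of `i + t` compared with `k`, the generator moves into `u`, prolongs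
the descending product, cancels its last factor, or moves into `u` with its index lowered. -/
theorem exists_eq_mul_descProd (hsq : ∀ i, i < N → x i * x i = 1)
    (hfar : ∀ i j, i + 2 ≤ j → j < N → x i * x j = x j * x i)
    (hbraid : ∀ i, i + 1 < N → x i * x (i + 1) * x i = x (i + 1) * x i * x (i + 1))
    {k : ℕ} (hk : k < N) {g : G} (hg : g ∈ initialClosure x (k + 1)) :
    ∃ u ∈ initialClosure x k, ∃ t ≤ k + 1, g = u * descProd x k t := by
  have hmem : ∀ i < k, x i ∈ initialClosure x k := fun i hi =>
    Submonoid.subset_closure ⟨i, hi, rfl⟩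
  induction hg using Submonoid.closure_induction_right with
  | one => exact ⟨1, one_mem _, 0, by omega, by simp [descProd]⟩
  | mul_right g _ y hy ih =>
    obtain ⟨i, hi, rfl⟩ := hy
    obtain ⟨u, hu, t, ht, rfl⟩ := ih
    rcases Nat.lt_trichotomy (i + t) k with h | h | h
    · exact ⟨u * x i, mul_mem hu (hmem i (by omega)), t, ht, by
        rw [mul_assoc, descProd_mul_of_far hfar hk t (by omega), mul_assoc]⟩
    · exact ⟨u, hu, t + 1, by omega, by
        rw [descProd, mul_assoc, show k - t = i by omega]⟩
    · rcases Nat.eq_or_lt_of_le (show k + 1 ≤ i + t from h) with h' | h'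
      · obtain ⟨s, rfl⟩ : ∃ s, t = s + 1 := ⟨t - 1, by omega⟩
        exact ⟨u, hu, s, by omega, by
          rw [descProd, show k - s = i by omega, mul_assoc, mul_assoc, hsq i (by omega),
            mul_one]⟩
      · obtain ⟨j, rfl⟩ : ∃ j, i = j + 1 := ⟨i - 1, by omega⟩
        exact ⟨u * x j, mul_mem hu (hmem j (by omega)), t, ht, by
          rw [mul_assoc, descProd_mul_of_braid hfar hbraid hk (by omega) t ht (by omega),
            mul_assoc]⟩

end Coxeter

theorem adj_mul_self {n : ℕ} (i : Fin (n - 1)) : adj i * adj i = 1 := swap_mul_self _ _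

theorem adj_apply {n : ℕ} (i : Fin (n - 1)) (k : Fin n) :
    ((adj i k : Fin n) : ℕ) =
      if (k : ℕ) = i then (i : ℕ) + 1 else if (k : ℕ) = (i : ℕ) + 1 then (i : ℕ) else (k : ℕ) := by
  rw [adj, swap_apply_def]
  simp only [Fin.ext_iff, lo, hi]
  split_ifs <;> rfl

theorem adj_far {n : ℕ} (i j : Fin (n - 1)) (h : (i : ℕ) + 2 ≤ j) :
    adj i * adj j = adj j * adj i := by
  ext k
  simp only [Perm.mul_apply, adj_apply]
  split_ifs <;> omega

theorem adj_braid {n : ℕ} (i j : Fin (n - 1)) (h : (i : ℕ) + 1 = j) :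
    adj i * adj j * adj i = adj j * adj i * adj j := by
  have e : lo j = hi i := Fin.ext h.symm
  have h1 : lo i ≠ hi i := by simp [lo, hi, Fin.ext_iff]
  have h2 : hi i ≠ hi j := by simp [hi, Fin.ext_iff]; omega
  have h3 : lo i ≠ hi j := by simp [lo, hi, Fin.ext_iff]; omega
  rw [adj, adj, e]
  rw [swap_mul_swap_mul_swap h1 h3, Equiv.swap_comm (lo i), Equiv.swap_comm (hi i) (hi j),
    swap_mul_swap_mul_swap h2.symm h3.symm, Equiv.swap_comm]

theorem prod_reverse_mul_prod {ι K : Type*} [Monoid K] (y : ι → K) (hy : ∀ i, y i * y i = 1)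
    (w : List ι) : (w.reverse.map y).prod * (w.map y).prod = 1 := by
  induction w with
  | nil => simp
  | cons i w ih =>
    rw [List.reverse_cons, List.map_append, List.prod_append, List.map_cons, List.prod_cons]
    simp only [List.map_cons, List.map_nil, List.prod_cons, List.prod_nil, mul_one]
    rw [mul_assoc, ← mul_assoc (y i), hy, one_mul, ih]

/-- Elements of a monoid that satisfy the Coxeter relations of type `A` have the same products
along words that represent the same permutation. -/
theorem prod_eq_of_coxeter {n : ℕ} {M : Type*} [Monoid M] {m : Fin (n - 1) → M}
    (hsq : ∀ i, m i * m i = 1)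
    (hfar : ∀ i j : Fin (n - 1), (i : ℕ) + 2 ≤ j → m i * m j = m j * m i)
    (hbraid : ∀ i j : Fin (n - 1), (i : ℕ) + 1 = j → m i * m j * m i = m j * m i * m j)
    {v w : List (Fin (n - 1))} (h : (v.map adj).prod = (w.map adj).prod) :
    (v.map m).prod = (w.map m).prod := by
  -- Pairing each transposition with its image in `M` turns the claim into this: in the submonoid
  -- generated by the pairs, the first component determines the second. The relations hold in both
  -- components, so the normal form is available for pairs.
  let x : ℕ → Perm (Fin n) × M := fun i => if h : i < n - 1 then (adj ⟨i, h⟩, m ⟨i, h⟩) else 1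
  have hx : ∀ i (h : i < n - 1), x i = (adj ⟨i, h⟩, m ⟨i, h⟩) := fun i h => dif_pos h
  have xsq : ∀ i, i < n - 1 → x i * x i = 1 := fun i h => by
    rw [hx i h, Prod.mk_mul_mk, adj_mul_self, hsq]; rfl
  have xfar : ∀ i j, i + 2 ≤ j → j < n - 1 → x i * x j = x j * x i := fun i j hij hj => by
    rw [hx i (by omega), hx j hj, Prod.mk_mul_mk, Prod.mk_mul_mk, adj_far _ _ hij,
      hfar _ _ hij]
  have xbraid : ∀ i, i + 1 < n - 1 → x i * x (i + 1) * x i = x (i + 1) * x i * x (i + 1) :=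
    fun i hi => by
      rw [hx i (by omega), hx (i + 1) hi]
      simp only [Prod.mk_mul_mk]
      rw [adj_braid _ _ rfl, hbraid _ _ rfl]
  have hfix : ∀ (k : ℕ) (hk : k < n) (g), g ∈ initialClosure x (k - 1) →
      g.1 ⟨k, hk⟩ = ⟨k, hk⟩ := by
    intro k hk g hg
    induction hg using Submonoid.closure_induction with
    | mem g hg =>
      obtain ⟨i, hi, rfl⟩ := hg
      rw [hx i (by omega)]
      ext
      simp only [adj_apply]
      split_ifs <;> omega
    | one => rfl
    | mul a b _ _ ha hb => rw [Prod.fst_mul, Perm.mul_apply, hb, ha]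
  have hdesc : ∀ (k : ℕ) (hk : k < n - 1) (t : ℕ) (_ : t ≤ k + 1),
      (descProd x k t).1 ⟨k + 1 - t, by omega⟩ = ⟨k + 1, by omega⟩ := by
    intro k hk t
    induction t with
    | zero => intro _; rfl
    | succ t ih =>
      intro ht
      rw [descProd, Prod.fst_mul, Perm.mul_apply, hx (k - t) (by omega), ← ih (by omega)]
      congr 1
      ext
      simp only [adj_apply]
      split_ifs <;> omega
  have hker : ∀ k, k ≤ n - 1 → ∀ g ∈ initialClosure x k, g.1 = 1 → g = 1 := by
    intro k
    induction k with
    | zero =>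
      intro _ g hg _
      simpa [initialClosure] using hg
    | succ k ih =>
      intro hk g hg h1
      obtain ⟨u, hu, t, ht, rfl⟩ := exists_eq_mul_descProd xsq xfar xbraid (by omega) hg
      -- The descending product sends `k + 1 - t` to `k + 1`, and `u` fixes `k + 1`. A trivial
      -- permutation thus forces `t = 0`, and induction applies to `u`.
      have e1 := hdesc k (by omega) t ht
      have e2 := hfix (k + 1) (by omega) u hu
      have e3 : ((u * descProd x k t).1 ⟨k + 1 - t, by omega⟩ : Fin n) = ⟨k + 1 - t, by omega⟩ := by
        rw [h1]; rfl
      rw [Prod.fst_mul, Perm.mul_apply, e1, e2, Fin.mk.injEq] at e3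
      obtain rfl : t = 0 := by omega
      rw [descProd, mul_one] at h1 ⊢
      exact ih (by omega) u hu h1
  have hword : ∀ w : List (Fin (n - 1)),
      ((w.map adj).prod, (w.map m).prod) ∈ initialClosure x (n - 1) := by
    intro w
    induction w with
    | nil => exact one_mem _
    | cons i w ih =>
      have : x i ∈ initialClosure x (n - 1) := Submonoid.subset_closure ⟨i, i.2, rfl⟩
      have := mul_mem this ih
      rw [hx i i.2, Prod.mk_mul_mk] at this
      simpa using this
  have hone : (v.map m).prod * (w.reverse.map m).prod = 1 := by
    have h1 := hker _ le_rfl _ (hword (v ++ w.reverse)) (by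
      simp only [List.map_append, List.prod_append]
      rw [h]
      have := prod_reverse_mul_prod (adj (n := n)) adj_mul_self w.reverse
      rwa [List.reverse_reverse] at this)
    have := congrArg Prod.snd h1
    simpa using this
  calc (v.map m).prod = (v.map m).prod * ((w.reverse.map m).prod * (w.map m).prod) := by
        rw [prod_reverse_mul_prod m hsq, mul_one]
    _ = (w.map m).prod := by rw [← mul_assoc, hone, one_mul]

/-! ### Young's orthogonal form satisfies the Coxeter relations -/

/-- The condition that a filling of the cells of `μ` is a standard tableau. -/
def IsStd {μ : YoungDiagram} {n : ℕ} (e : Fin n ≃ μ.cells) : Prop :=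
  (∀ a b, (e a).1.1 = (e b).1.1 → (e a).1.2 < (e b).1.2 → a < b) ∧
    (∀ a b, (e a).1.2 = (e b).1.2 → (e a).1.1 < (e b).1.1 → a < b)

/-- The content of the cell of the letter `k` in a filling. -/
def cellContent {μ : YoungDiagram} {n : ℕ} (e : Fin n ≃ μ.cells) (k : Fin n) : ℤ :=
  ((e k).1.2 : ℤ) - ((e k).1.1 : ℤ)

section Fillings

variable {μ : YoungDiagram} {n : ℕ}

/-- Entries increase weakly towards the lower right: go from one cell to the other through the
corner in the row of the first and the column of the second, which lies in the diagram because the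
diagram is a lower set. -/
theorem IsStd.exists_between {e : Fin n ≃ μ.cells} (he : IsStd e) {j k : Fin n}
    {c : ℕ × ℕ}
    (h1 : (e j).1.1 ≤ c.1) (h2 : c.1 ≤ (e k).1.1) (h3 : (e j).1.2 ≤ c.2) (h4 : c.2 ≤ (e k).1.2) :
    ∃ l, (e l).1 = c ∧ j ≤ l ∧ l ≤ k := by
  have hmono : ∀ a b : Fin n, (e a).1.1 ≤ (e b).1.1 → (e a).1.2 ≤ (e b).1.2 → a ≤ b := by
    intro a b h1 h2
    have hmem : ((e a).1.1, (e b).1.2) ∈ μ.cells :=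
      μ.isLowerSet (show ((e a).1.1, (e b).1.2) ≤ (e b).1 from ⟨h1, le_rfl⟩) (e b).2
    have ha : a ≤ e.symm ⟨_, hmem⟩ := by
      rcases h2.eq_or_lt with h | h
      · exact le_of_eq (e.injective (by
          rw [e.apply_symm_apply]; exact Subtype.ext (Prod.ext rfl h)))
      · exact (he.1 _ _ (by simp) (by simpa using h)).le
    have hb : e.symm ⟨_, hmem⟩ ≤ b := by
      rcases h1.eq_or_lt with h | h
      · exact le_of_eq (e.injective (by
          rw [e.apply_symm_apply]; exact Subtype.ext (Prod.ext h rfl)))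
      · exact (he.2 _ _ (by simp) (by simpa using h)).le
    exact ha.trans hb
  have hmem : c ∈ μ.cells := μ.isLowerSet (show c ≤ (e k).1 from ⟨h2, h4⟩) (e k).2
  exact ⟨e.symm ⟨c, hmem⟩, by simp, hmono _ _ (by simpa using h1) (by simpa using h3),
    hmono _ _ (by simpa using h2) (by simpa using h4)⟩

/-- Letters on a common diagonal of a standard tableau differ by at least `3`. -/
theorem IsStd.add_three_le {e : Fin n ≃ μ.cells} (he : IsStd e) {j k : Fin n} (hjk : j < k)
    (hc : cellContent e j = cellContent e k) : (j : ℕ) + 3 ≤ k := by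
  have key : ∀ j k : Fin n, cellContent e j = cellContent e k → (e j).1.1 < (e k).1.1 →
      (j : ℕ) + 3 ≤ k := by
    intro j k hc hr
    unfold cellContent at hc
    -- The two cells span a square, whose other two corners hold two different letters strictly
    -- between `j` and `k`.
    obtain ⟨a, ha, ha1, ha2⟩ := he.exists_between (j := j) (k := k) (c := ((e j).1.1, (e k).1.2))
      (by simp) (by simp; omega) (by simp; omega) (by simp)
    obtain ⟨b, hb, hb1, hb2⟩ := he.exists_between (j := j) (k := k) (c := ((e k).1.1, (e j).1.2))
      (by simp; omega) (by simp) (by simp) (by simp; omega)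
    have h1 : a ≠ b := by
      rintro rfl
      rw [ha] at hb
      have := congrArg Prod.fst hb
      simp at this
      omega
    have h2 : a ≠ j := by rintro rfl; have := congrArg Prod.snd ha; simp at this; omega
    have h3 : a ≠ k := by rintro rfl; have := congrArg Prod.fst ha; simp at this; omega
    have h4 : b ≠ j := by rintro rfl; have := congrArg Prod.fst hb; simp at this; omega
    have h5 : b ≠ k := by rintro rfl; have := congrArg Prod.snd hb; simp at this; omega
    omega
  rcases Nat.lt_trichotomy (e j).1.1 (e k).1.1 with h | h | h
  · exact key j k hc h
  · unfold cellContent at hc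
    have : e j = e k := Subtype.ext (Prod.ext h (by omega))
    exact absurd (e.injective this) hjk.ne
  · have := key k j hc.symm h
    omega

theorem lo_lt_hi (i : Fin (n - 1)) : lo i < hi i := by simp [lo, hi, Fin.lt_def]

theorem adj_lo (i : Fin (n - 1)) : adj i (lo i) = hi i := swap_apply_left _ _

theorem adj_hi (i : Fin (n - 1)) : adj i (hi i) = lo i := swap_apply_right _ _

theorem adj_of_ne (i : Fin (n - 1)) {k : Fin n} (h1 : k ≠ lo i) (h2 : k ≠ hi i) : adj i k = k :=
  swap_apply_of_ne_of_ne h1 h2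

theorem eq_lo_hi_of_adj_lt {i : Fin (n - 1)} {a b : Fin n} (h1 : adj i a < adj i b)
    (h2 : ¬ a < b) : a = hi i ∧ b = lo i := by
  rw [Fin.lt_def, adj_apply, adj_apply] at h1
  simp only [Fin.ext_iff, lo, hi, Fin.lt_def] at h2 ⊢
  split_ifs at h1 <;> omega

/-- If exchanging `i` and `i + 1` destroys standardness, then the two letters are neighbours. -/
theorem IsStd.content_of_not_isStd {e : Fin n ≃ μ.cells} (he : IsStd e) {i : Fin (n - 1)}
    (h : ¬ IsStd ((adj i).trans e)) :
    cellContent e (hi i) - cellContent e (lo i) = 1 ∨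
      cellContent e (hi i) - cellContent e (lo i) = -1 := by
  have hlt := lo_lt_hi i
  have hl : ((lo i : Fin n) : ℕ) = i := rfl
  have hh : ((hi i : Fin n) : ℕ) = i + 1 := rfl
  rw [IsStd, not_and_or] at h
  unfold cellContent
  rcases h with h | h
  · push Not at h
    obtain ⟨a, b, h1, h2, h3⟩ := h
    simp only [trans_apply] at h1 h2
    obtain ⟨rfl, rfl⟩ := eq_lo_hi_of_adj_lt (he.1 _ _ h1 h2) (not_lt.2 h3)
    rw [adj_hi, adj_lo] at h1 h2
    left
    by_contra hne
    -- If the cells were not adjacent, the cell right of `lo i` would hold a letter strictly between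
    -- the consecutive letters `lo i` and `hi i`. The column case below is the same with the next
    -- lower cell.
    obtain ⟨l, hl, hl1, hl2⟩ := he.exists_between (j := lo i) (k := hi i)
      (c := ((e (lo i)).1.1, (e (lo i)).1.2 + 1)) (by simp)
      (by simp; omega) (by simp) (by simp; omega)
    have n1 : l ≠ lo i := by rintro rfl; have := congrArg Prod.snd hl; simp at this
    have n2 : l ≠ hi i := by rintro rfl; have := congrArg Prod.snd hl; simp at this; omega
    omega
  · push Not at h
    obtain ⟨a, b, h1, h2, h3⟩ := h
    simp only [trans_apply] at h1 h2
    obtain ⟨rfl, rfl⟩ := eq_lo_hi_of_adj_lt (he.2 _ _ h1 h2) (not_lt.2 h3)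
    rw [adj_hi, adj_lo] at h1 h2
    right
    by_contra hne
    obtain ⟨l, hl, hl1, hl2⟩ := he.exists_between (j := lo i) (k := hi i)
      (c := ((e (lo i)).1.1 + 1, (e (lo i)).1.2)) (by simp)
      (by simp; omega) (by simp) (by simp; omega)
    have n1 : l ≠ lo i := by rintro rfl; have := congrArg Prod.fst hl; simp at this
    have n2 : l ≠ hi i := by rintro rfl; have := congrArg Prod.fst hl; simp at this; omega
    omega

theorem trans_adj_trans_adj (i : Fin (n - 1)) (e : Fin n ≃ μ.cells) :
    (adj i).trans ((adj i).trans e) = e := by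
  ext1 k
  simp only [trans_apply]
  rw [← Perm.mul_apply, adj_mul_self, Perm.one_apply]

theorem cellContent_trans (σ : Perm (Fin n)) (e : Fin n ≃ μ.cells) (k : Fin n) :
    cellContent (σ.trans e) k = cellContent e (σ k) := rfl

end Fillings

/-- The diagonal entry of Young's orthogonal form at axial distance `r`. -/
def diagCoeff (r : ℤ) : ℂ := ((1 / (r : ℝ) : ℝ) : ℂ)

/-- The off-diagonal entry of Young's orthogonal form at axial distance `r`. -/
def swapCoeff (r : ℤ) : ℂ := ((Real.sqrt (1 - 1 / (r : ℝ) ^ 2) : ℝ) : ℂ)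

theorem diagCoeff_neg (r : ℤ) : diagCoeff (-r) = -diagCoeff r := by
  rw [diagCoeff, diagCoeff]
  push_cast
  rw [div_neg]

theorem swapCoeff_neg (r : ℤ) : swapCoeff (-r) = swapCoeff r := by
  simp [swapCoeff]

/-- This holds at `r = 0` too, where `1 / 0 = 0`, so involutivity of the matrices needs no case
distinction. -/
theorem swapCoeff_mul_self (r : ℤ) : swapCoeff r * swapCoeff r = 1 - diagCoeff r * diagCoeff r := by
  have h : (0 : ℝ) ≤ 1 - 1 / (r : ℝ) ^ 2 := by
    rcases eq_or_ne r 0 with rfl | hr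
    · simp
    · have h1 : (1 : ℝ) ≤ (r : ℝ) ^ 2 := by
        have : (1 : ℤ) ≤ r ^ 2 := Int.add_one_le_iff.2 (sq_pos_of_ne_zero hr)
        exact_mod_cast this
      rw [sub_nonneg]
      exact div_le_one_of_le₀ h1 (by positivity)
  rw [swapCoeff, diagCoeff, ← Complex.ofReal_mul, Real.mul_self_sqrt h]
  push_cast
  ring

/-- The partial fraction identity `1 / (a b) = (1 / a + 1 / b) / (a + b)`, which is what makes the
braid relation true. -/
theorem diagCoeff_add {a b : ℤ} (ha : a ≠ 0) (hb : b ≠ 0) (hab : a + b ≠ 0) :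
    diagCoeff a * diagCoeff b = diagCoeff (a + b) * (diagCoeff a + diagCoeff b) := by
  have ha' : (a : ℂ) ≠ 0 := by exact_mod_cast ha
  have hb' : (b : ℂ) ≠ 0 := by exact_mod_cast hb
  have hab' : (a : ℂ) + b ≠ 0 := by exact_mod_cast hab
  simp only [diagCoeff]
  push_cast
  field_simp
  ring

section Young

variable {μ : YoungDiagram} {n : ℕ}

/-- Extension by zero of a vector indexed by standard tableaux to all fillings. -/
def extend (v : StdTableau μ n → ℂ) (e : Fin n ≃ μ.cells) : ℂ := by
  classical
  exact if h : IsStd e then v ⟨e, h⟩ else 0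

theorem StdTableau.isStd (T : StdTableau μ n) : IsStd T.1 := T.2

theorem IsStd.exists_tableau {e : Fin n ≃ μ.cells} (he : IsStd e) :
    ∃ T : StdTableau μ n, T.1 = e := ⟨⟨e, he⟩, rfl⟩

theorem StdTableau.ext {T U : StdTableau μ n} (h : T.1 = U.1) : T = U := Subtype.ext h

theorem extend_val (v : StdTableau μ n → ℂ) (T : StdTableau μ n) : extend v T.1 = v T :=
  dif_pos T.isStd

theorem extend_of_not (v : StdTableau μ n → ℂ) {e : Fin n ≃ μ.cells} (he : ¬ IsStd e) :
    extend v e = 0 := dif_neg he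

theorem extend_injective : Function.Injective (extend (μ := μ) (n := n)) := by
  intro v w h
  funext T
  rw [← extend_val v, h, extend_val]

/-- Young's orthogonal form of an adjacent transposition on functions of all fillings. -/
def fillingOp (i : Fin (n - 1)) (w : (Fin n ≃ μ.cells) → ℂ) (e : Fin n ≃ μ.cells) : ℂ :=
  diagCoeff (cellContent e (hi i) - cellContent e (lo i)) * w e +
    swapCoeff (cellContent e (hi i) - cellContent e (lo i)) * w ((adj i).trans e)

theorem yorAdj_apply (i : Fin (n - 1)) (U T : StdTableau μ n) :
    yorAdj μ i U T = if U = T then diagCoeff (T.content (hi i) - T.content (lo i))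
      else if U.1 = (adj i).trans T.1 then swapCoeff (T.content (hi i) - T.content (lo i))
      else 0 := by
  simp only [yorAdj, of_apply, diagCoeff, swapCoeff, Equiv.ext_iff, trans_apply]

theorem trans_adj_ne (i : Fin (n - 1)) (e : Fin n ≃ μ.cells) : (adj i).trans e ≠ e := by
  intro h
  have := e.injective (Equiv.congr_fun h (lo i))
  rw [adj_lo] at this
  exact (lo_lt_hi i).ne' this

/-- Vectors on tableaux, extended by zero, are stable under the operator on all fillings: when an
exchange leads from a non-standard filling to a standard one, the letters are neighbours, so the
axial distance is `±1` and the off-diagonal coefficient vanishes. The Coxeter relations become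
identities between explicit operators, without asking which exchanges stay standard. -/
theorem extend_mulVec (i : Fin (n - 1)) (v : StdTableau μ n → ℂ) :
    extend (yorAdj μ i *ᵥ v) = fillingOp i (extend v) := by
  funext e
  rw [fillingOp]
  by_cases he : IsStd e
  · obtain ⟨T, rfl⟩ := he.exists_tableau
    rw [extend_val, extend_val]
    change ∑ U, yorAdj μ i T U * v U = _
    by_cases he' : IsStd ((adj i).trans T.1)
    · obtain ⟨T', hT'⟩ := he'.exists_tableau
      rw [← hT', extend_val]
      have hne : T' ≠ T := fun h => trans_adj_ne i T.1 (by rw [← hT', h])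
      rw [Finset.sum_eq_add T T' hne.symm]
      · rw [yorAdj_apply, if_pos rfl, yorAdj_apply, if_neg hne.symm, hT',
          if_pos (trans_adj_trans_adj i T.1).symm]
        congr 2
        rw [← swapCoeff_neg]
        congr 1
        change -(cellContent T'.1 (hi i) - cellContent T'.1 (lo i)) = _
        rw [hT', cellContent_trans, cellContent_trans, adj_hi, adj_lo, neg_sub]
      · intro U _ hU
        rw [yorAdj_apply, if_neg hU.1.symm, if_neg, zero_mul]
        intro h
        exact hU.2 (StdTableau.ext (by rw [hT', h, trans_adj_trans_adj]))
      · intro h; exact absurd (Finset.mem_univ _) h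
      · intro h; exact absurd (Finset.mem_univ _) h
    · rw [extend_of_not _ he', mul_zero, add_zero, Finset.sum_eq_single T]
      · rw [yorAdj_apply, if_pos rfl]; rfl
      · intro U _ hU
        rw [yorAdj_apply, if_neg hU.symm, if_neg, zero_mul]
        intro h
        refine he' ?_
        rw [h, trans_adj_trans_adj]
        exact U.2
      · intro h; exact absurd (Finset.mem_univ _) h
  · rw [extend_of_not _ he, extend_of_not _ he, mul_zero, zero_add]
    by_cases he' : IsStd ((adj i).trans e)
    · have := he'.content_of_not_isStd (i := i) (by rwa [trans_adj_trans_adj])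
      rw [cellContent_trans, cellContent_trans, adj_hi, adj_lo] at this
      have hz : swapCoeff (cellContent e (hi i) - cellContent e (lo i)) = 0 := by
        rcases this with h | h
        · rw [← swapCoeff_neg, neg_sub, h]; simp [swapCoeff]
        · rw [← swapCoeff_neg, neg_sub, h]; simp [swapCoeff]
      rw [hz, zero_mul]
    · rw [extend_of_not _ he', mul_zero]

/-- Standard fillings suffice, since both extensions vanish elsewhere. For the braid relation this
matters, as axial distances can be zero in non-standard fillings. -/
theorem eq_of_extend_mulVec {A B : Matrix (StdTableau μ n) (StdTableau μ n) ℂ}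
    (h : ∀ v e, IsStd e → extend (A *ᵥ v) e = extend (B *ᵥ v) e) : A = B := by
  refine Matrix.ext_of_mulVec_single fun T => extend_injective ?_
  funext e
  by_cases he : IsStd e
  · exact h _ e he
  · rw [extend_of_not _ he, extend_of_not _ he]

theorem yorAdj_mul_self (i : Fin (n - 1)) : yorAdj μ i * yorAdj μ i = 1 := by
  refine eq_of_extend_mulVec fun v e _ => ?_
  rw [← mulVec_mulVec, extend_mulVec, extend_mulVec, one_mulVec]
  simp only [fillingOp, trans_adj_trans_adj, cellContent_trans, adj_hi, adj_lo]
  rw [← neg_sub (cellContent e (hi i)), diagCoeff_neg, swapCoeff_neg]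
  linear_combination extend v e *
    swapCoeff_mul_self (cellContent e (hi i) - cellContent e (lo i))

theorem yorAdj_far (i j : Fin (n - 1)) (h : (i : ℕ) + 2 ≤ j) :
    yorAdj μ i * yorAdj μ j = yorAdj μ j * yorAdj μ i := by
  refine eq_of_extend_mulVec fun v e _ => ?_
  rw [← mulVec_mulVec, ← mulVec_mulVec]
  simp only [extend_mulVec]
  have e1 : adj i (lo j) = lo j := adj_of_ne i (by simp [lo, Fin.ext_iff]; omega)
    (by simp [lo, hi, Fin.ext_iff]; omega)
  have e2 : adj i (hi j) = hi j := adj_of_ne i (by simp [lo, hi, Fin.ext_iff]; omega)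
    (by simp [hi, Fin.ext_iff]; omega)
  have e3 : adj j (lo i) = lo i := adj_of_ne j (by simp [lo, Fin.ext_iff]; omega)
    (by simp [lo, hi, Fin.ext_iff]; omega)
  have e4 : adj j (hi i) = hi i := adj_of_ne j (by simp [lo, hi, Fin.ext_iff]; omega)
    (by simp [hi, Fin.ext_iff]; omega)
  have e5 : (adj i).trans ((adj j).trans e) = (adj j).trans ((adj i).trans e) := by
    have := adj_far i j h
    ext1 k
    simp only [trans_apply, ← Perm.mul_apply, this]
  simp only [fillingOp, cellContent_trans, e1, e2, e3, e4, e5]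
  ring

theorem yorAdj_braid (i j : Fin (n - 1)) (h : (i : ℕ) + 1 = j) :
    yorAdj μ i * yorAdj μ j * yorAdj μ i = yorAdj μ j * yorAdj μ i * yorAdj μ j := by
  refine eq_of_extend_mulVec fun v e he => ?_
  rw [← mulVec_mulVec, ← mulVec_mulVec, ← mulVec_mulVec, ← mulVec_mulVec]
  simp only [extend_mulVec]
  have e0 : lo j = hi i := Fin.ext h.symm
  have hv1 : (lo i).val = i := rfl
  have hv2 : (hi i).val = i + 1 := rfl
  have hv3 : (hi j).val = i + 2 := by change (j : ℕ) + 1 = _; omega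
  have e1 : adj i (hi j) = hi j := adj_of_ne i (by rw [Ne, Fin.ext_iff]; omega)
    (by rw [Ne, Fin.ext_iff]; omega)
  have e2 : adj j (lo i) = lo i := adj_of_ne j (by rw [e0, Ne, Fin.ext_iff]; omega)
    (by rw [Ne, Fin.ext_iff]; omega)
  have e3 : adj j (hi i) = hi j := by rw [← e0, adj_lo]
  have e4 : adj j (hi j) = hi i := by rw [adj_hi, e0]
  have e5 : (adj i).trans ((adj j).trans ((adj i).trans e)) =
      (adj j).trans ((adj i).trans ((adj j).trans e)) := by
    have := adj_braid i j h
    ext1 k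
    simp only [trans_apply, ← Perm.mul_apply, ← mul_assoc, this]
  -- Three consecutive letters lie on different diagonals of a standard tableau, as letters on a
  -- common diagonal differ by at least `3`.
  have n1 : cellContent e (hi i) - cellContent e (lo i) ≠ 0 := fun h0 => by
    have := he.add_three_le (j := lo i) (k := hi i) (by rw [Fin.lt_def]; omega) (by omega)
    omega
  have n2 : cellContent e (hi j) - cellContent e (hi i) ≠ 0 := fun h0 => by
    have := he.add_three_le (j := hi i) (k := hi j) (by rw [Fin.lt_def]; omega) (by omega)
    omega
  have n3 : cellContent e (hi j) - cellContent e (lo i) ≠ 0 := fun h0 => by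
    have := he.add_three_le (j := lo i) (k := hi j) (by rw [Fin.lt_def]; omega) (by omega)
    omega
  simp only [fillingOp, cellContent_trans, e0, e1, e2, e3, e4, e5, adj_lo, adj_hi,
    trans_adj_trans_adj]
  rw [← neg_sub (cellContent e (hi i)) (cellContent e (lo i)),
    ← neg_sub (cellContent e (hi j)) (cellContent e (hi i))]
  simp only [diagCoeff_neg, swapCoeff_neg]
  have key := diagCoeff_add n1 n2 (by omega)
  rw [show cellContent e (hi i) - cellContent e (lo i) +
    (cellContent e (hi j) - cellContent e (hi i)) = cellContent e (hi j) - cellContent e (lo i) by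
    ring] at key
  have s1 := swapCoeff_mul_self (cellContent e (hi i) - cellContent e (lo i))
  have s2 := swapCoeff_mul_self (cellContent e (hi j) - cellContent e (hi i))
  generalize diagCoeff (cellContent e (hi i) - cellContent e (lo i)) = p at *
  generalize diagCoeff (cellContent e (hi j) - cellContent e (hi i)) = q at *
  generalize diagCoeff (cellContent e (hi j) - cellContent e (lo i)) = t at *
  generalize swapCoeff (cellContent e (hi i) - cellContent e (lo i)) = P at *
  generalize swapCoeff (cellContent e (hi j) - cellContent e (hi i)) = Q at *
  generalize swapCoeff (cellContent e (hi j) - cellContent e (lo i)) = R at *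
  -- The two sides agree at the fillings reached by two or three exchanges. At one exchange the
  -- difference is a multiple of `key`; at `e` itself `P ^ 2 = 1 - p ^ 2` and `Q ^ 2 = 1 - q ^ 2`
  -- are also needed.
  linear_combination ((p - q) * extend v e + P * extend v ((adj i).trans e) -
    Q * extend v ((adj j).trans e)) * key + extend v e * t * s1 - extend v e * t * s2

/-- `yor` chooses a word; the Coxeter relations make the choice irrelevant. -/
theorem yor_prod (w : List (Fin (n - 1))) : yor μ (w.map adj).prod = (w.map (yorAdj μ)).prod :=
  prod_eq_of_coxeter yorAdj_mul_self yorAdj_far yorAdj_braid (exists_word _).choose_spec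

theorem yor_adj (i : Fin (n - 1)) : yor μ (adj i) = yorAdj μ i := by
  simpa using yor_prod (μ := μ) [i]

theorem yor_one : yor μ (1 : Perm (Fin n)) = 1 := by
  simpa using yor_prod (μ := μ) (n := n) []

theorem yor_mul (σ τ : Perm (Fin n)) : yor μ (σ * τ) = yor μ σ * yor μ τ := by
  obtain ⟨v, rfl⟩ := exists_word σ
  obtain ⟨w, rfl⟩ := exists_word τ
  rw [← List.prod_append, ← List.map_append, yor_prod, yor_prod, yor_prod, List.map_append,
    List.prod_append]

theorem yorAdj_conjTranspose (i : Fin (n - 1)) : (yorAdj μ i)ᴴ = yorAdj μ i := by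
  ext U T
  have hd : ∀ r, star (diagCoeff r) = diagCoeff r := fun r => Complex.conj_ofReal _
  have hs : ∀ r, star (swapCoeff r) = swapCoeff r := fun r => Complex.conj_ofReal _
  rw [conjTranspose_apply, yorAdj_apply, yorAdj_apply]
  by_cases h : U = T
  · subst h; simp [hd]
  · rw [if_neg (Ne.symm h), if_neg h]
    by_cases h' : U.1 = (adj i).trans T.1
    · rw [if_pos h', if_pos (by rw [h', trans_adj_trans_adj]), hs, ← swapCoeff_neg]
      congr 1
      change -(cellContent U.1 (hi i) - cellContent U.1 (lo i)) =
        cellContent T.1 _ - cellContent T.1 _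
      rw [h', cellContent_trans, cellContent_trans, adj_hi, adj_lo, neg_sub]
    · rw [if_neg h', if_neg, star_zero]
      intro h2
      exact h' (by rw [h2, trans_adj_trans_adj])

theorem adj_inv (i : Fin (n - 1)) : (adj i)⁻¹ = adj i := swap_inv _ _

theorem yor_conjTranspose (σ : Perm (Fin n)) : (yor μ σ)ᴴ = yor μ σ⁻¹ := by
  obtain ⟨w, rfl⟩ := exists_word σ
  induction w with
  | nil => simp [yor_one]
  | cons i w ih =>
    rw [List.map_cons, List.prod_cons, yor_mul, conjTranspose_mul, ih, _root_.mul_inv_rev, yor_mul,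
      yor_adj, yorAdj_conjTranspose, adj_inv, yor_adj]

end Young

/-! ### Jucys–Murphy elements act on tableaux by contents -/

section JucysMurphy

variable {μ : YoungDiagram} {n : ℕ}

theorem IsStd.row_add_col_le {e : Fin n ≃ μ.cells} (he : IsStd e) :
    ∀ (m : ℕ) (k : Fin n), (e k).1.1 + (e k).1.2 = m → m ≤ k
  | 0, _, _ => Nat.zero_le _
  | m + 1, k, h => by
    rcases Nat.eq_zero_or_pos (e k).1.1 with h0 | h0
    · have hmem : ((e k).1.1, (e k).1.2 - 1) ∈ μ.cells :=
        μ.isLowerSet (show ((e k).1.1, (e k).1.2 - 1) ≤ (e k).1 from ⟨le_rfl, Nat.sub_le _ _⟩)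
          (e k).2
      have h1 := he.row_add_col_le m (e.symm ⟨_, hmem⟩) (by simp; omega)
      have h2 := he.1 (e.symm ⟨_, hmem⟩) k (by simp) (by simp; omega)
      rw [Fin.lt_def] at h2
      omega
    · have hmem : ((e k).1.1 - 1, (e k).1.2) ∈ μ.cells :=
        μ.isLowerSet (show ((e k).1.1 - 1, (e k).1.2) ≤ (e k).1 from ⟨Nat.sub_le _ _, le_rfl⟩)
          (e k).2
      have h1 := he.row_add_col_le m (e.symm ⟨_, hmem⟩) (by simp; omega)
      have h2 := he.2 (e.symm ⟨_, hmem⟩) k (by simp) (by simp; omega)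
      rw [Fin.lt_def] at h2
      omega

/-- The image of the Jucys–Murphy element of the letter `k` in Young's orthogonal form. -/
def jucysMurphy (μ : YoungDiagram) (k : Fin n) : Matrix (StdTableau μ n) (StdTableau μ n) ℂ :=
  ∑ j with j < k, yor μ (swap j k)

theorem swap_hi (i : Fin (n - 1)) {j : Fin n} (h : j < lo i) :
    swap j (hi i) = adj i * swap j (lo i) * adj i := by
  have h1 := lo_lt_hi i
  have := swap_apply_apply (adj i) j (lo i)
  rwa [adj_lo, adj_of_ne i h.ne (h.trans h1).ne, adj_inv] at this

theorem StdTableau.content_hi_ne (T : StdTableau μ n) (i : Fin (n - 1)) :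
    T.content (hi i) - T.content (lo i) ≠ 0 := by
  intro h
  have := T.isStd.add_three_le (lo_lt_hi i) (sub_eq_zero.1 h).symm
  simp [lo, hi] at this

/-- Young's orthogonal form is an eigenbasis of the Jucys–Murphy elements. -/
theorem jucysMurphy_eq (μ : YoungDiagram) (k : Fin n) :
    jucysMurphy μ k = diagonal fun T : StdTableau μ n => (T.content k : ℂ) := by
  obtain ⟨k, hk⟩ := k
  induction k with
  | zero =>
    rw [jucysMurphy, Finset.filter_eq_empty_iff.2 (fun j _ h => by simp [Fin.lt_def] at h),
      Finset.sum_empty, ← diagonal_zero]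
    congr 1
    funext T
    have := T.isStd.row_add_col_le _ ⟨0, hk⟩ rfl
    rw [StdTableau.content, show (T.1 ⟨0, hk⟩).1.1 = 0 by simp at this; omega,
      show (T.1 ⟨0, hk⟩).1.2 = 0 by simp at this; omega]
    simp
  | succ k ih =>
    specialize ih (by omega)
    set i : Fin (n - 1) := ⟨k, by omega⟩
    change jucysMurphy μ (lo i) = diagonal fun T : StdTableau μ n => (T.content (lo i) : ℂ) at ih
    change jucysMurphy μ (hi i) = diagonal fun T : StdTableau μ n => (T.content (hi i) : ℂ)
    -- The recursion `J' = s J s + s` between consecutive Jucys–Murphy elements, from conjugating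
    -- the transpositions by `s`.
    have h1 : jucysMurphy μ (hi i) =
        yorAdj μ i * jucysMurphy μ (lo i) * yorAdj μ i + yorAdj μ i := by
      have hset : (Finset.univ.filter fun j => j < hi i) =
          insert (lo i) (Finset.univ.filter fun j => j < lo i) := by
        ext j
        simp [Fin.lt_def, Fin.ext_iff, lo, hi]
        omega
      rw [jucysMurphy, hset, Finset.sum_insert (by simp), add_comm, jucysMurphy, Finset.mul_sum,
        Finset.sum_mul]
      congr 1
      · refine Finset.sum_congr rfl fun j hj => ?_
        rw [swap_hi i (Finset.mem_filter.1 hj).2, yor_mul, yor_mul, yor_adj]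
      · exact yor_adj i
    -- The relation `C' s = s C + 1` for the diagonal matrices of contents. Its diagonal part says
    -- that the diagonal entry of `s` is the inverse axial distance; off the diagonal it says that
    -- exchanging the letters exchanges their contents. With `s * s = 1` it gives the induction
    -- step.
    have h2 : (diagonal fun T : StdTableau μ n => (T.content (hi i) : ℂ)) * yorAdj μ i =
        yorAdj μ i * (diagonal fun T : StdTableau μ n => (T.content (lo i) : ℂ)) + 1 := by
      ext U T
      rw [Matrix.add_apply, diagonal_mul, mul_diagonal, yorAdj_apply, Matrix.one_apply]
      by_cases h : U = T
      · subst h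
        rw [if_pos rfl, if_pos rfl]
        have hr := U.content_hi_ne i
        have hr' : (U.content (hi i) : ℂ) - U.content (lo i) ≠ 0 := by exact_mod_cast hr
        have : diagCoeff (U.content (hi i) - U.content (lo i)) *
            ((U.content (hi i) : ℂ) - U.content (lo i)) = 1 := by
          rw [diagCoeff]; push_cast; rw [one_div, inv_mul_cancel₀ hr']
        linear_combination this
      · rw [if_neg h, if_neg h]
        by_cases h' : U.1 = (adj i).trans T.1
        · have : U.content (hi i) = T.content (lo i) := by
            change cellContent U.1 _ = cellContent T.1 _
            rw [h', cellContent_trans, adj_hi]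
          rw [this]; ring
        · rw [if_neg h']; ring
    rw [h1, ih]
    calc _ = (yorAdj μ i * (diagonal fun T : StdTableau μ n => (T.content (lo i) : ℂ)) + 1) *
          yorAdj μ i := by rw [add_mul, one_mul]
      _ = _ := by rw [← h2, mul_assoc, yorAdj_mul_self, mul_one]

end JucysMurphy

/-! ### The projection `tau` -/

theorem mem_lastTwoStab {n : ℕ} {h : Perm (Fin n)} :
    h ∈ lastTwoStab n ↔ ∀ k : Fin n, n ≤ (k : ℕ) + 2 → h k = k := by
  rw [mem_fixingSubgroup_iff]
  rfl

theorem swap_mem_lastTwoStab {n : ℕ} {a b : Fin n} (ha : (a : ℕ) + 2 < n) (hb : (b : ℕ) + 2 < n) :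
    swap a b ∈ lastTwoStab n :=
  mem_lastTwoStab.2 fun k hk => swap_apply_of_ne_of_ne (by rintro rfl; omega) (by rintro rfl; omega)

section Tau

variable {μ : YoungDiagram} {n : ℕ}

theorem card_lastTwoStab_ne_zero : (Nat.card (lastTwoStab n) : ℂ) ≠ 0 := by
  exact_mod_cast Nat.card_pos.ne'

theorem yor_mul_tau {h : Perm (Fin n)} (hh : h ∈ lastTwoStab n) :
    yor μ h * tau (yor μ) = tau (yor μ) := by
  classical
  rw [tau, mul_smul_comm, Finset.mul_sum]
  congr 1
  refine Finset.sum_equiv (Equiv.mulLeft h) (fun g => ?_) (fun g _ => ?_)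
  · simp [(lastTwoStab n).mul_mem_cancel_left hh]
  · rw [← yor_mul]; rfl

theorem tau_conjTranspose : (tau (yor μ))ᴴ = tau (yor μ (n := n)) := by
  classical
  rw [tau, conjTranspose_smul, conjTranspose_sum]
  congr 1
  · simp
  · refine Finset.sum_equiv (Equiv.inv _) (fun g => ?_) (fun g _ => ?_)
    · simp
    · rw [yor_conjTranspose]; rfl

/-- The transpositions in the Jucys–Murphy element of a letter `k` among the first `n - 2` lie in
the stabilizer, so it multiplies `tau` by their number `k`. It also multiplies row `T` by the
content of `k`, which is less than `k` unless `k` lies in the first row. -/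
theorem tau_apply_of_not_isActive {T : StdTableau μ n} (hT : ¬ T.IsActive) (U : StdTableau μ n) :
    tau (yor μ) T U = 0 := by
  unfold StdTableau.IsActive at hT
  push Not at hT
  obtain ⟨k, hk, hrow⟩ := hT
  have h1 : jucysMurphy μ k * tau (yor μ) = (k : ℂ) • tau (yor μ) := by
    rw [jucysMurphy, Finset.sum_mul, Finset.sum_congr rfl fun j hj => yor_mul_tau
      (swap_mem_lastTwoStab (by have := (Finset.mem_filter.1 hj).2; rw [Fin.lt_def] at this; omega)
        hk), Finset.sum_const, ← Nat.cast_smul_eq_nsmul ℂ]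
    congr 2
    rw [Finset.filter_gt_eq_Iio, Fin.card_Iio]
  rw [jucysMurphy_eq] at h1
  have h2 := congrFun (congrFun h1 T) U
  rw [diagonal_mul, Matrix.smul_apply, smul_eq_mul] at h2
  have h3 : (T.content k : ℂ) - (k : ℂ) ≠ 0 := by
    have := T.isStd.row_add_col_le _ k rfl
    unfold StdTableau.row at hrow
    have : T.content k - ((k : ℕ) : ℤ) ≠ 0 := by unfold StdTableau.content; omega
    exact_mod_cast this
  have h4 : ((T.content k : ℂ) - (k : ℂ)) * tau (yor μ) T U = 0 := by
    rw [sub_mul, h2, sub_self]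
  exact (mul_eq_zero.1 h4).resolve_left h3

theorem StdTableau.col_lt_of_row_eq (T : StdTableau μ n) {j k : Fin n} (h : j < k)
    (hr : T.row j = T.row k) : (T.1 j).1.2 < (T.1 k).1.2 := by
  rcases Nat.lt_trichotomy (T.1 j).1.2 (T.1 k).1.2 with h1 | h1 | h1
  · exact h1
  · exact absurd (T.1.injective (Subtype.ext (Prod.ext hr h1))) h.ne
  · exact absurd (T.isStd.1 k j hr.symm h1) h.le.not_gt

theorem StdTableau.IsActive.col_eq {T : StdTableau μ n} (hT : T.IsActive) :
    ∀ (m : ℕ) (h : m + 2 < n), (T.1 ⟨m, by omega⟩).1.2 = m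
  | 0, h => by
    have := T.isStd.row_add_col_le _ ⟨0, by omega⟩ rfl
    simp at this; omega
  | m + 1, h => by
    have h1 := T.isStd.row_add_col_le _ ⟨m + 1, by omega⟩ rfl
    have h2 := hT.col_eq m (by omega)
    have h3 := T.col_lt_of_row_eq (j := ⟨m, by omega⟩) (k := ⟨m + 1, by omega⟩)
      (by simp [Fin.lt_def])
      (by rw [hT _ (by simp; omega), hT _ (by simpa using h)])
    simp only at h1
    omega

/-- In an active tableau two consecutive letters among the first `n - 2` are neighbours in the first
row, with axial distance `1`: Young's form has the entry `1` on the diagonal and `√0` off it. Such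
transpositions generate the stabilizer. -/
theorem yor_apply_of_isActive {T : StdTableau μ n} (hT : T.IsActive) {h : Perm (Fin n)}
    (hh : h ∈ lastTwoStab n) (U : StdTableau μ n) :
    yor μ h U T = (1 : Matrix (StdTableau μ n) (StdTableau μ n) ℂ) U T := by
  have hmul : ∀ σ τ : Perm (Fin n),
      (∀ U, yor μ σ U T = (1 : Matrix (StdTableau μ n) (StdTableau μ n) ℂ) U T) →
      (∀ U, yor μ τ U T = (1 : Matrix (StdTableau μ n) (StdTableau μ n) ℂ) U T) →
      ∀ U, yor μ (σ * τ) U T = (1 : Matrix (StdTableau μ n) (StdTableau μ n) ℂ) U T := by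
    intro σ τ h1 h2 U
    rw [yor_mul, Matrix.mul_apply, Finset.sum_congr rfl fun V _ => by rw [h2 V],
      ← Matrix.mul_apply, mul_one, h1]
  have hadj : ∀ i : Fin (n - 1), (i : ℕ) + 3 < n →
      ∀ U, yor μ (adj i) U T = (1 : Matrix (StdTableau μ n) (StdTableau μ n) ℂ) U T := by
    intro i hi3 U
    have h1 : T.content (hi i) - T.content (lo i) = 1 := by
      have e1 := hT (hi i) (by simp [hi]; omega)
      have e2 := hT (lo i) (by simp [lo]; omega)
      unfold StdTableau.row at e1 e2
      rw [StdTableau.content, StdTableau.content, e1, e2, hi, lo, hT.col_eq _ (by omega),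
        hT.col_eq _ (by omega)]
      push_cast; ring
    rw [yor_adj, yorAdj_apply, h1, Matrix.one_apply]
    simp [diagCoeff, swapCoeff]
  have hswap : ∀ (b a : ℕ) (ha : a < b) (hb : b + 2 < n) (U),
      yor μ (swap (⟨a, by omega⟩ : Fin n) ⟨b, by omega⟩) U T =
        (1 : Matrix (StdTableau μ n) (StdTableau μ n) ℂ) U T := by
    intro b
    induction b with
    | zero => intro a ha; omega
    | succ b ih =>
      intro a ha hb
      set i : Fin (n - 1) := ⟨b, by omega⟩ with hidef
      rcases Nat.lt_succ_iff_lt_or_eq.1 ha with h | h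
      · have := swap_hi i (j := ⟨a, by omega⟩) (by simp [lo, Fin.lt_def, hidef, h])
        change ∀ U, yor μ (swap ⟨a, _⟩ (hi i)) U T = _
        rw [this]
        exact hmul _ _ (hmul _ _ (hadj i (by simp [hidef]; omega)) (ih a h (by omega)))
          (hadj i (by simp [hidef]; omega))
      · subst h
        exact hadj i (by simp [hidef]; omega)
  have hsub : ∀ f : Perm {k : Fin n // (k : ℕ) + 2 < n}, ∀ U,
      yor μ (Perm.ofSubtype f) U T = (1 : Matrix (StdTableau μ n) (StdTableau μ n) ℂ) U T := by
    intro f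
    induction f using Perm.swap_induction_on with
    | one => intro U; rw [map_one, yor_one]
    | swap_mul f x y hxy ih =>
      rw [map_mul, Perm.ofSubtype_swap_eq]
      refine hmul _ _ ?_ ih
      rcases lt_or_gt_of_ne (show (x.1 : ℕ) ≠ y.1 from fun h => hxy (Subtype.ext (Fin.ext h)))
        with h | h
      · exact hswap y.1 x.1 h y.2
      · rw [Equiv.swap_comm]
        exact hswap x.1 y.1 h x.2
  have hst : ∀ x, ((h x : Fin n) : ℕ) + 2 < n ↔ (x : ℕ) + 2 < n := by
    intro x
    rw [← not_iff_not, not_lt, not_lt]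
    rw [mem_lastTwoStab] at hh
    constructor
    · intro hx
      rwa [h.injective (hh _ hx)] at hx
    · intro hx
      rwa [hh _ hx]
  have := hsub (h.subtypePerm hst) U
  rwa [Perm.ofSubtype_subtypePerm hst fun x hx => by
    by_contra hlt
    exact hx (mem_lastTwoStab.1 hh x (by omega))] at this

-- Active columns are averages of identity columns; the other columns vanish because the
-- corresponding rows do and `tau` is Hermitian.
open Classical in
theorem tau_eq_diagonal : tau (yor μ) =
    diagonal fun T : StdTableau μ n => if T.IsActive then (1 : ℂ) else 0 := by
  ext U T
  by_cases hT : T.IsActive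
  · have h1 : tau (yor μ) U T = (1 : Matrix (StdTableau μ n) (StdTableau μ n) ℂ) U T := by
      rw [tau, Matrix.smul_apply, Matrix.sum_apply, Finset.sum_congr rfl fun h hh =>
        yor_apply_of_isActive hT (Finset.mem_filter.1 hh).2 U, Finset.sum_const, smul_eq_mul,
        nsmul_eq_mul, ← mul_assoc, ← Fintype.card_subtype, ← Nat.card_eq_fintype_card]
      rw [one_div, inv_mul_cancel₀, one_mul]
      exact card_lastTwoStab_ne_zero
    rw [h1, Matrix.one_apply, diagonal_apply]
    by_cases h : U = T
    · subst h; simp [hT]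
    · simp [h]
  · have h1 : tau (yor μ) U T = 0 := by
      rw [← tau_conjTranspose, conjTranspose_apply, tau_apply_of_not_isActive hT, star_zero]
    rw [h1, diagonal_apply]
    by_cases h : U = T
    · subst h; simp [hT]
    · simp [h]

end Tau

/-! ### Double cosets as types of ordered pairs -/

/-- The position of an ordered pair `(x, y)` of distinct letters relative to the pair `(a, b)`. -/
def pairType {n : ℕ} (a b x y : Fin n) : Fin 7 :=
  if x = a then (if y = b then 0 else 3)
  else if x = b then (if y = a then 1 else 4)
  else if y = b then 2 else if y = a then 5 else 6

/-- The sum of a function of pairs over the pairs in position `c` relative to `(a, b)`. -/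
def typeSum {n : ℕ} (F : Fin n → Fin n → ℂ) (c : Fin 7) (a b : Fin n) : ℂ :=
  ∑ x, ∑ y, if pairType a b x y = c then F x y else 0

/-- The number of pairs of distinct letters in position `c` relative to a pair. -/
def typeCard (n : ℕ) : Fin 7 → ℕ :=
  ![1, 1, n - 2, n - 2, n - 2, n - 2, (n - 2) * (n - 3)]

/-- `typeSum` in terms of row sums, column sums and the total. -/
def typeSumFormula {n : ℕ} (F : Fin n → Fin n → ℂ) (a b : Fin n) : Fin 7 → ℂ :=
  ![F a b, F b a, ∑ x, F x b - F a b, ∑ y, F a y - F a b, ∑ y, F b y - F b a, ∑ x, F x a - F b a,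
    ∑ x, ∑ y, F x y - ∑ y, F a y - ∑ y, F b y - ∑ x, F x a - ∑ x, F x b + F a b + F b a]

section PairType

variable {n : ℕ}

theorem pairType_perm (g : Perm (Fin n)) (a b x y : Fin n) :
    pairType (g a) (g b) (g x) (g y) = pairType a b x y := by
  simp only [pairType, g.injective.eq_iff]

theorem typeSum_perm (g : Perm (Fin n)) (F : Fin n → Fin n → ℂ) (c : Fin 7) (a b : Fin n) :
    typeSum F c (g a) (g b) = ∑ x, ∑ y, if pairType a b x y = c then F (g x) (g y) else 0 := by
  rw [typeSum, ← Equiv.sum_comp g]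
  refine Finset.sum_congr rfl fun x _ => ?_
  rw [← Equiv.sum_comp g]
  simp only [pairType_perm]

/-- Inclusion–exclusion over the coincidences of `x, y` with `a, b`. This is the source of the
speed: each type sum costs a bounded number of operations once row sums, column sums and the total
are known. -/
theorem typeSum_eq {F : Fin n → Fin n → ℂ} (hF : ∀ x, F x x = 0) (c : Fin 7) {a b : Fin n}
    (hab : a ≠ b) : typeSum F c a b = typeSumFormula F a b c := by
  have hab' := hab.symm
  -- An opaque copy of `F`: the equations `s1` to `s4`, used from right to left, turn every term
  -- into a double sum over `G`, to which they no longer apply, so that rewriting stops.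
  obtain ⟨G, hG⟩ : ∃ G, G = F := ⟨F, rfl⟩
  have s1 : ∀ u v, (∑ x, ∑ y, if x = u ∧ y = v then G x y else 0) = F u v := by
    intro u v
    simp [ite_and, hG]
  have s2 : ∀ v, (∑ x, ∑ y, if y = v then G x y else 0) = ∑ x, F x v := by
    intro v
    simp [hG]
  have s3 : ∀ u, (∑ x, ∑ y, if x = u then G x y else 0) = ∑ y, F u y := by
    intro u
    rw [Finset.sum_comm]
    simp [hG]
  have s4 : ∑ x, ∑ y, G x y = ∑ x, ∑ y, F x y := by rw [hG]
  have s5 : (∑ x, ∑ y, if pairType a b x y = c then F x y else 0) =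
    ∑ x, ∑ y, if pairType a b x y = c then G x y else 0 := by rw [hG]
  have hcase : ∀ x y, (x = y → G x y = 0) := fun x y h => by rw [hG, h, hF]
  rw [typeSum, s5]
  fin_cases c <;>
    simp only [typeSumFormula, Fin.zero_eta, Fin.mk_one, Fin.reduceFinMk, cons_val] <;>
    (try simp only [← s4]) <;> (try simp only [← s2, ← s3]) <;>
    simp only [← s1, ← Finset.sum_sub_distrib, ← Finset.sum_add_distrib] <;>
    refine Finset.sum_congr rfl fun x _ => Finset.sum_congr rfl fun y _ => ?_ <;>
    have h := hcase x y <;>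
    clear s1 s2 s3 s4 s5 hcase hF hG <;>
    unfold pairType <;>
    grind

theorem typeSum_one (hn : 4 ≤ n) (c : Fin 7) {a b : Fin n} (hab : a ≠ b) :
    typeSum (fun x y => if x = y then 0 else 1) c a b = (typeCard n c : ℂ) := by
  rw [typeSum_eq (by simp) c hab]
  have h1 : ∀ u : Fin n, (∑ x, if x = u then (0 : ℂ) else 1) = (n : ℂ) - 1 := by
    intro u
    have : ∀ x : Fin n, (if x = u then (0 : ℂ) else 1) = 1 - if x = u then 1 else 0 := by
      intro x; split_ifs <;> simp
    simp [this]
  have h2 : ∀ u : Fin n, (∑ x, if u = x then (0 : ℂ) else 1) = (n : ℂ) - 1 := by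
    intro u
    simp only [eq_comm (a := u), h1]
  have e2 : ((n - 2 : ℕ) : ℂ) = n - 2 := by rw [Nat.cast_sub (by omega)]; simp
  have e3 : ((n - 3 : ℕ) : ℂ) = n - 3 := by rw [Nat.cast_sub (by omega)]; simp
  fin_cases c <;>
    simp only [typeSumFormula, typeCard, Fin.zero_eta, Fin.mk_one, Fin.reduceFinMk, cons_val, h1,
      h2, hab, hab.symm, if_false, Nat.cast_one, Nat.cast_mul, e2, e3, Finset.sum_const,
      Finset.card_univ, Fintype.card_fin, nsmul_eq_mul] <;>
    ring

end PairType

/-! ### Pairs of letters as cosets, and averages over double cosets -/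

section LastTwo

variable {n : ℕ} (hn : 4 ≤ n)

theorem val_pt (j : Fin 4) : (pt hn j : ℕ) = n - 4 + j := rfl

theorem pt_two_ne_pt_three : pt hn 2 ≠ pt hn 3 := by
  rw [Ne, Fin.ext_iff, val_pt, val_pt]
  simp

theorem ne_pt_iff (k : Fin n) : (k : ℕ) + 2 < n ↔ k ≠ pt hn 2 ∧ k ≠ pt hn 3 := by
  rw [Ne, Ne, Fin.ext_iff, Fin.ext_iff, val_pt, val_pt]
  have e2 : ((2 : Fin 4) : ℕ) = 2 := rfl
  have e3 : ((3 : Fin 4) : ℕ) = 3 := rfl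
  omega

theorem mem_lastTwoStab_iff {h : Perm (Fin n)} :
    h ∈ lastTwoStab n ↔ h (pt hn 2) = pt hn 2 ∧ h (pt hn 3) = pt hn 3 := by
  rw [mem_lastTwoStab]
  constructor
  · intro hh
    exact ⟨hh _ (by rw [val_pt]; change n ≤ n - 4 + 2 + 2; omega),
      hh _ (by rw [val_pt]; change n ≤ n - 4 + 3 + 2; omega)⟩
  · rintro ⟨h1, h2⟩ k hk
    have := (ne_pt_iff hn k).not.1 (by omega)
    by_cases h3 : k = pt hn 2
    · rw [h3, h1]
    · rw [show k = pt hn 3 by tauto, h2]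

/-- Permutations with the same values at the last two letters lie in the same coset. -/
theorem inv_mul_mem_lastTwoStab {σ τ : Perm (Fin n)} (h2 : σ (pt hn 2) = τ (pt hn 2))
    (h3 : σ (pt hn 3) = τ (pt hn 3)) : σ⁻¹ * τ ∈ lastTwoStab n := by
  rw [mem_lastTwoStab_iff hn, Perm.mul_apply, Perm.mul_apply, ← h2, ← h3]
  exact ⟨σ.symm_apply_apply _, σ.symm_apply_apply _⟩

/-- By injectivity the second transposition does not disturb the first image. The explicit form lets
`exists_mem_lastTwoStab` place each factor in the stabilizer. -/
theorem exists_perm_apply_eq {x y x' y' : Fin n} (h : x ≠ y) (h' : x' ≠ y') :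
    (swap (swap x x' y) y' * swap x x') x = x' ∧ (swap (swap x x' y) y' * swap x x') y = y' := by
  constructor
  · rw [Perm.mul_apply, swap_apply_left]
    refine swap_apply_of_ne_of_ne ?_ h'
    intro h0
    have : swap x x' x = swap x x' y := by rw [swap_apply_left]; exact h0
    exact h ((swap x x').injective this)
  · rw [Perm.mul_apply, swap_apply_left]

/-- The stabilizer of the last two letters acts transitively on the pairs of each type. -/
theorem exists_mem_lastTwoStab {x y x' y' : Fin n} (h : x ≠ y) (h' : x' ≠ y')
    (ht : pairType (pt hn 2) (pt hn 3) x y = pairType (pt hn 2) (pt hn 3) x' y') :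
    ∃ k ∈ lastTwoStab n, k x = x' ∧ k y = y' := by
  refine ⟨_, ?_, exists_perm_apply_eq h h'⟩
  have hx : x = x' ∨ ((x : ℕ) + 2 < n ∧ (x' : ℕ) + 2 < n) := by
    rw [ne_pt_iff hn, ne_pt_iff hn]
    unfold pairType at ht
    split_ifs at ht <;> first | exact absurd ht (by decide) | (subst_vars; tauto)
  have hy : y = y' ∨ ((y : ℕ) + 2 < n ∧ (y' : ℕ) + 2 < n) := by
    rw [ne_pt_iff hn, ne_pt_iff hn]
    unfold pairType at ht
    split_ifs at ht <;> first | exact absurd ht (by decide) | (subst_vars; tauto)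
  have hs : swap x x' ∈ lastTwoStab n := by
    rcases hx with rfl | ⟨h1, h2⟩
    · rw [swap_self]; exact one_mem _
    · exact swap_mem_lastTwoStab h1 h2
  refine mul_mem ?_ hs
  rcases hy with rfl | ⟨h1, h2⟩
  · rcases hx with rfl | ⟨h3, h4⟩
    · rw [swap_self]
      simp only [refl_apply, swap_self]
      exact one_mem _
    · by_cases h5 : (y : ℕ) + 2 < n
      · refine swap_mem_lastTwoStab ?_ h5
        rw [swap_apply_def]; split_ifs <;> assumption
      · rw [swap_apply_of_ne_of_ne (by rintro rfl; exact h5 h3) (by rintro rfl; exact h5 h4),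
          swap_self]
        exact one_mem _
  · refine swap_mem_lastTwoStab ?_ h2
    rcases hx with rfl | ⟨h3, h4⟩
    · rw [swap_self]; exact h1
    · rw [swap_apply_def]; split_ifs <;> assumption

theorem exists_perm_pt {x y : Fin n} (h : x ≠ y) :
    ∃ σ : Perm (Fin n), σ (pt hn 2) = x ∧ σ (pt hn 3) = y :=
  ⟨_, exists_perm_apply_eq (pt_two_ne_pt_three hn) h⟩

/-- Summation over the symmetric group of a function of the images of the last two letters. -/
theorem sum_perm_eq (w : Fin n → Fin n → ℂ) :
    ∑ σ : Perm (Fin n), w (σ (pt hn 2)) (σ (pt hn 3)) =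
      Nat.card (lastTwoStab n) * ∑ x, ∑ y, if x = y then 0 else w x y := by
  classical
  have hcard : ∀ x y : Fin n, x ≠ y →
      (Finset.univ.filter fun σ : Perm (Fin n) => (σ (pt hn 2), σ (pt hn 3)) = (x, y)).card =
        Nat.card (lastTwoStab n) := by
    intro x y h
    obtain ⟨κ, h2, h3⟩ := exists_perm_pt hn h
    rw [Nat.card_eq_fintype_card, Fintype.card_subtype]
    refine Finset.card_equiv (Equiv.mulLeft κ⁻¹) fun σ => ?_
    simp only [Finset.mem_filter, Finset.mem_univ, true_and, Prod.mk.injEq, coe_mulLeft]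
    constructor
    · rintro ⟨e2, e3⟩
      exact inv_mul_mem_lastTwoStab hn (h2.trans e2.symm) (h3.trans e3.symm)
    · intro hm
      rw [mem_lastTwoStab_iff hn, Perm.mul_apply, Perm.mul_apply, Perm.inv_eq_iff_eq,
        Perm.inv_eq_iff_eq, h2, h3] at hm
      exact hm
  rw [← Finset.sum_fiberwise Finset.univ (fun σ : Perm (Fin n) => (σ (pt hn 2), σ (pt hn 3))),
    Fintype.sum_prod_type, Finset.mul_sum]
  refine Finset.sum_congr rfl fun x _ => ?_
  rw [Finset.mul_sum]
  refine Finset.sum_congr rfl fun y _ => ?_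
  rw [Finset.sum_congr rfl (g := fun _ => w x y) fun σ hσ => by
    have := (Finset.mem_filter.1 hσ).2
    rw [Prod.mk.injEq] at this
    rw [this.1, this.2], Finset.sum_const, nsmul_eq_mul]
  by_cases h : x = y
  · rw [if_pos h, Finset.card_eq_zero.2, Nat.cast_zero, zero_mul, mul_zero]
    refine Finset.filter_eq_empty_iff.2 fun σ _ h0 => ?_
    rw [Prod.mk.injEq] at h0
    exact pt_two_ne_pt_three hn (σ.injective (h0.1.trans (h.trans h0.2.symm)))
  · rw [if_neg h, hcard x y h]

theorem factorial_eq_card_mul {n : ℕ} (hn : 4 ≤ n) :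
    (n.factorial : ℂ) = Nat.card (lastTwoStab n) * ((n : ℂ) * ((n : ℂ) - 1)) := by
  have := sum_perm_eq hn (fun _ _ => 1)
  rw [Finset.sum_const, Finset.card_univ, Fintype.card_perm, Fintype.card_fin, nsmul_one] at this
  rw [this]
  congr 1
  have h1 : ∀ x y : Fin n, (if x = y then (0 : ℂ) else 1) = 1 - if x = y then 1 else 0 := by
    intro x y; split_ifs <;> simp
  simp [h1]
  ring

/-- A correlation with a translate depends on the translation only up to its double coset, so that
the translate may be averaged over the double coset. -/
theorem sum_mul_translate (P F : Fin n → Fin n → ℂ) (σ : Perm (Fin n)) {c : Fin 7}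
    (hσ : pairType (pt hn 2) (pt hn 3) (σ (pt hn 2)) (σ (pt hn 3)) = c) (hF : ∀ x, F x x = 0) :
    (typeCard n c : ℂ) * ∑ g : Perm (Fin n), P (g (pt hn 2)) (g (pt hn 3)) *
        F ((g * σ) (pt hn 2)) ((g * σ) (pt hn 3)) =
      ∑ g : Perm (Fin n), P (g (pt hn 2)) (g (pt hn 3)) *
        typeSum F c (g (pt hn 2)) (g (pt hn 3)) := by
  -- The correlation as a function of the pair `(x, y)` that is translated. Substituting `g * k` for
  -- `g` shows that it is invariant under the stabilizer, hence constant on pairs of one type.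
  set Z : Fin n → Fin n → ℂ := fun x y =>
    ∑ g : Perm (Fin n), P (g (pt hn 2)) (g (pt hn 3)) * F (g x) (g y) with hZ
  have hinv : ∀ k ∈ lastTwoStab n, ∀ x y, Z (k x) (k y) = Z x y := by
    intro k hk x y
    rw [mem_lastTwoStab_iff hn] at hk
    simp only [hZ]
    rw [← Equiv.sum_comp (Equiv.mulRight k)
      (fun g : Perm (Fin n) => P (g (pt hn 2)) (g (pt hn 3)) * F (g x) (g y))]
    simp only [coe_mulRight, Perm.mul_apply, hk.1, hk.2]
  have hne : σ (pt hn 2) ≠ σ (pt hn 3) := fun h => pt_two_ne_pt_three hn (σ.injective h)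
  have hR : ∑ g : Perm (Fin n), P (g (pt hn 2)) (g (pt hn 3)) *
        typeSum F c (g (pt hn 2)) (g (pt hn 3)) = ∑ x, ∑ y, ∑ g : Perm (Fin n),
        P (g (pt hn 2)) (g (pt hn 3)) *
          if pairType (pt hn 2) (pt hn 3) x y = c then F (g x) (g y) else 0 := by
    simp only [typeSum_perm, Finset.mul_sum]
    rw [Finset.sum_comm]
    exact Finset.sum_congr rfl fun x _ => Finset.sum_comm
  rw [hR, ← typeSum_one hn c (pt_two_ne_pt_three hn), typeSum, Finset.sum_mul]
  refine Finset.sum_congr rfl fun x _ => ?_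
  rw [Finset.sum_mul]
  refine Finset.sum_congr rfl fun y _ => ?_
  change _ * Z (σ (pt hn 2)) (σ (pt hn 3)) = _
  by_cases h : pairType (pt hn 2) (pt hn 3) x y = c
  · rw [if_pos h]
    by_cases hxy : x = y
    · subst hxy
      simp [hF]
    · obtain ⟨k, hk, e1, e2⟩ := exists_mem_lastTwoStab hn hne hxy (hσ.trans h.symm)
      rw [if_neg hxy, one_mul, ← hinv k hk, e1, e2]
      simp only [h, if_true]
      rfl
  · simp [h]

end LastTwo

/-! ### Entries of Young's orthogonal representation on double cosets -/

/-- The sum over the pairs in position `c` of the entry of Young's orthogonal representation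
between two active tableaux; `δ` is the entry of the identity matrix, `s` the entry of the last
adjacent transposition, `α` and `β` the contents of the last two letters. -/
def typeWeight (δ s α β : ℂ) : Fin 7 → ℂ :=
  ![δ, s, α * δ, β * δ - s, α * s, β * s - δ, (α * β + 1) * δ - (α + β) * s]

/-- The index of the adjacent transposition of the last two letters. -/
def lastAdj {n : ℕ} (hn : 4 ≤ n) : Fin (n - 1) := ⟨n - 2, by omega⟩

section Weights

variable {n : ℕ} (hn : 4 ≤ n) {μ : YoungDiagram}

theorem lo_lastAdj : lo (lastAdj hn) = pt hn 2 := by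
  ext; rw [val_pt]; change n - 2 = n - 4 + 2; omega

theorem hi_lastAdj : hi (lastAdj hn) = pt hn 3 := by
  ext; rw [val_pt]; change n - 2 + 1 = n - 4 + 3; omega

theorem adj_lastAdj : adj (lastAdj hn) = swap (pt hn 2) (pt hn 3) := by
  rw [adj, lo_lastAdj, hi_lastAdj]

/-- Permutations of one type differ by stabilizer elements on the left and on the right, and these
act trivially on active rows and columns. -/
theorem yor_apply_eq_of_pairType {T U : StdTableau μ n} (hT : T.IsActive) (hU : U.IsActive)
    {σ τ : Perm (Fin n)}
    (h : pairType (pt hn 2) (pt hn 3) (σ (pt hn 2)) (σ (pt hn 3)) =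
      pairType (pt hn 2) (pt hn 3) (τ (pt hn 2)) (τ (pt hn 3))) :
    yor μ σ T U = yor μ τ T U := by
  have hne := pt_two_ne_pt_three hn
  obtain ⟨k, hk, h2, h3⟩ := exists_mem_lastTwoStab hn (σ.injective.ne hne) (τ.injective.ne hne) h
  have hm : (k * σ)⁻¹ * τ ∈ lastTwoStab n := inv_mul_mem_lastTwoStab hn h2 h3
  have hrow : ∀ V, yor μ k T V = (1 : Matrix (StdTableau μ n) (StdTableau μ n) ℂ) T V := by
    intro V
    have := yor_apply_of_isActive hT ((lastTwoStab n).inv_mem hk) V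
    rw [← yor_conjTranspose, conjTranspose_apply] at this
    rw [← star_star (yor μ k T V), this, Matrix.one_apply, Matrix.one_apply]
    by_cases h' : T = V
    · subst h'; simp
    · simp [h', Ne.symm h']
  have e : τ = k * (σ * ((k * σ)⁻¹ * τ)) := by group
  rw [e, yor_mul, Matrix.mul_apply, Finset.sum_congr rfl fun V _ => by rw [hrow V],
    ← Matrix.mul_apply, one_mul, yor_mul, Matrix.mul_apply,
    Finset.sum_congr rfl fun V _ => by rw [yor_apply_of_isActive hU hm V], ← Matrix.mul_apply,
    mul_one]

theorem card_lt_pt_two : ((Finset.univ.filter fun j : Fin n => j < pt hn 2).card : ℂ) = n - 2 := by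
  rw [Finset.filter_gt_eq_Iio, Fin.card_Iio, val_pt, show n - 4 + ((2 : Fin 4) : ℕ) = n - 2 by
    change n - 4 + 2 = _; omega, Nat.cast_sub (by omega)]
  simp

theorem lt_pt_two_iff (j : Fin n) : j < pt hn 2 ↔ j ≠ pt hn 2 ∧ j ≠ pt hn 3 := by
  rw [← ne_pt_iff hn, Fin.lt_def, val_pt]
  change _ < n - 4 + 2 ↔ _
  omega

theorem jucysMurphy_pt_three : jucysMurphy μ (pt hn 3) =
    ∑ j with j < pt hn 2, yor μ (swap j (pt hn 3)) + yorAdj μ (lastAdj hn) := by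
  have hset : (Finset.univ.filter fun j => j < pt hn 3) =
      insert (pt hn 2) (Finset.univ.filter fun j => j < pt hn 2) := by
    ext j
    simp only [Finset.mem_filter, Finset.mem_univ, true_and, Finset.mem_insert, Fin.lt_def,
      Fin.ext_iff, val_pt]
    change _ < n - 4 + 3 ↔ _ = n - 4 + 2 ∨ _ < n - 4 + 2
    omega
  rw [jucysMurphy, hset, Finset.sum_insert (by simp), add_comm, ← adj_lastAdj, yor_adj]

/-- With `s` the last adjacent transposition and `J`, `J'` the last two Jucys–Murphy elements, the
sums over one permutation for each pair of types `2` to `5` are `J`, `J' - s`, `J s` and `J' s - 1`.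
Type `6` comes from expanding `J J'`. As `J` and `J'` are diagonal, all these entries are explicit.
-/
theorem typeCard_mul_yor_apply {T U : StdTableau μ n} (hT : T.IsActive) (hU : U.IsActive)
    {σ : Perm (Fin n)} {c : Fin 7}
    (hσ : pairType (pt hn 2) (pt hn 3) (σ (pt hn 2)) (σ (pt hn 3)) = c) :
    (typeCard n c : ℂ) * yor μ σ T U =
      typeWeight ((1 : Matrix (StdTableau μ n) (StdTableau μ n) ℂ) T U)
        (yorAdj μ (lastAdj hn) T U) (T.content (pt hn 2)) (T.content (pt hn 3)) c := by
  have hne := pt_two_ne_pt_three hn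
  have hne' := hne.symm
  have e2 : ((n - 2 : ℕ) : ℂ) = n - 2 := by rw [Nat.cast_sub (by omega)]; simp
  have e3 : ((n - 3 : ℕ) : ℂ) = n - 3 := by rw [Nat.cast_sub (by omega)]; simp
  have sA : ∀ j, j < pt hn 2 → swap j (pt hn 2) (pt hn 2) = j ∧
      swap j (pt hn 2) (pt hn 3) = pt hn 3 := fun j hj =>
    ⟨swap_apply_right _ _, swap_apply_of_ne_of_ne ((lt_pt_two_iff hn j).1 hj).2.symm hne'⟩
  have sB : ∀ j, j < pt hn 2 → swap j (pt hn 3) (pt hn 3) = j ∧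
      swap j (pt hn 3) (pt hn 2) = pt hn 2 := fun j hj =>
    ⟨swap_apply_right _ _, swap_apply_of_ne_of_ne ((lt_pt_two_iff hn j).1 hj).1.symm hne⟩
  have sL : adj (lastAdj hn) (pt hn 2) = pt hn 3 ∧ adj (lastAdj hn) (pt hn 3) = pt hn 2 := by
    rw [adj_lastAdj]; exact ⟨swap_apply_left _ _, swap_apply_right _ _⟩
  have J2 : (jucysMurphy μ (pt hn 2)) = ∑ j with j < pt hn 2, yor μ (swap j (pt hn 2)) := rfl
  have J3 := jucysMurphy_pt_three hn (μ := μ)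
  have D : ∀ (k : Fin n) (M : Matrix (StdTableau μ n) (StdTableau μ n) ℂ),
      (jucysMurphy μ k * M) T U = (T.content k : ℂ) * M T U := fun k M => by
    rw [jucysMurphy_eq, diagonal_mul]
  have D1 : ∀ k, jucysMurphy μ k T U = (T.content k : ℂ) *
      (1 : Matrix (StdTableau μ n) (StdTableau μ n) ℂ) T U := fun k => by
    rw [← D, mul_one]
  -- a sum of entries over permutations of one type
  have K : ∀ (c : Fin 7) (σ : Perm (Fin n)) (g : Fin n → Perm (Fin n)),
      pairType (pt hn 2) (pt hn 3) (σ (pt hn 2)) (σ (pt hn 3)) = c →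
      (∀ j, j < pt hn 2 →
        pairType (pt hn 2) (pt hn 3) (g j (pt hn 2)) (g j (pt hn 3)) = c) →
      ∑ j with j < pt hn 2, yor μ (g j) T U = ((n : ℂ) - 2) * yor μ σ T U := by
    intro c σ g hσ hg
    rw [Finset.sum_congr rfl fun j hj => yor_apply_eq_of_pairType hn hT hU
      ((hg j (Finset.mem_filter.1 hj).2).trans hσ.symm), Finset.sum_const, nsmul_eq_mul,
      card_lt_pt_two]
  have H4 : ∀ σ : Perm (Fin n),
      pairType (pt hn 2) (pt hn 3) (σ (pt hn 2)) (σ (pt hn 3)) = 4 →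
      ((n : ℂ) - 2) * yor μ σ T U = T.content (pt hn 2) * yorAdj μ (lastAdj hn) T U := by
    intro σ hσ
    rw [← K 4 σ (fun j => swap j (pt hn 2) * adj (lastAdj hn)) hσ ?_, ← D, J2, Finset.sum_mul,
      Matrix.sum_apply]
    · exact Finset.sum_congr rfl fun j _ => by rw [yor_mul, yor_adj]
    · intro j hj
      have := (lt_pt_two_iff hn j).1 hj
      simp only [Perm.mul_apply, sL, sA j hj]
      simp [pairType, hne', this]
  have H5 : ∀ σ : Perm (Fin n),
      pairType (pt hn 2) (pt hn 3) (σ (pt hn 2)) (σ (pt hn 3)) = 5 →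
      ((n : ℂ) - 2) * yor μ σ T U = T.content (pt hn 3) * yorAdj μ (lastAdj hn) T U -
        (1 : Matrix (StdTableau μ n) (StdTableau μ n) ℂ) T U := by
    intro σ hσ
    rw [← K 5 σ (fun j => swap j (pt hn 3) * adj (lastAdj hn)) hσ ?_, ← D, J3, add_mul,
      yorAdj_mul_self, Matrix.add_apply, add_sub_cancel_right, Finset.sum_mul, Matrix.sum_apply]
    · exact Finset.sum_congr rfl fun j _ => by rw [yor_mul, yor_adj]
    · intro j hj
      have := (lt_pt_two_iff hn j).1 hj
      simp only [Perm.mul_apply, sL, sB j hj]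
      simp [pairType, hne, this]
  fin_cases c <;>
    simp only [typeWeight, typeCard, Fin.zero_eta, Fin.mk_one, Fin.reduceFinMk, cons_val,
      Nat.cast_one, one_mul, Nat.cast_mul, e2, e3] at hσ ⊢
  · rw [← yor_one]
    exact yor_apply_eq_of_pairType hn hT hU (hσ.trans (by simp [pairType]))
  · rw [← yor_adj]
    exact yor_apply_eq_of_pairType hn hT hU (hσ.trans (by simp [pairType, sL, hne']))
  · rw [← K 2 σ (fun j => swap j (pt hn 2)) hσ ?_, ← D1, J2, Matrix.sum_apply]
    intro j hj
    have := (lt_pt_two_iff hn j).1 hj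
    simp only [sA j hj]
    simp [pairType, this]
  · rw [← K 3 σ (fun j => swap j (pt hn 3)) hσ ?_, ← D1, J3, Matrix.add_apply,
      add_sub_cancel_right, Matrix.sum_apply]
    intro j hj
    have := (lt_pt_two_iff hn j).1 hj
    simp only [sB j hj]
    simp [pairType, this]
  · exact H4 σ hσ
  · exact H5 σ hσ
  · have h0 : (⟨0, by omega⟩ : Fin n) < pt hn 2 := by
      rw [Fin.lt_def, val_pt]; change 0 < n - 4 + 2; omega
    have h0' := (lt_pt_two_iff hn _).1 h0
    set z : Fin n := ⟨0, by omega⟩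
    have t4 : ∀ j, j < pt hn 2 → pairType (pt hn 2) (pt hn 3)
        ((swap j (pt hn 2) * adj (lastAdj hn)) (pt hn 2))
        ((swap j (pt hn 2) * adj (lastAdj hn)) (pt hn 3)) = 4 := by
      intro j hj
      have := (lt_pt_two_iff hn j).1 hj
      simp only [Perm.mul_apply, sL, sA j hj]
      simp [pairType, hne', this]
    have t5 : ∀ i, i < pt hn 2 → pairType (pt hn 2) (pt hn 3)
        ((swap i (pt hn 2) * swap i (pt hn 3)) (pt hn 2))
        ((swap i (pt hn 2) * swap i (pt hn 3)) (pt hn 3)) = 5 := by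
      intro i hi'
      have := (lt_pt_two_iff hn i).1 hi'
      simp only [Perm.mul_apply, sB i hi', sA i hi', swap_apply_left]
      simp [pairType, hne, this]
    have t6 : ∀ i, i < pt hn 2 → ∀ j, j < pt hn 2 → j ≠ i → pairType (pt hn 2) (pt hn 3)
        ((swap i (pt hn 2) * swap j (pt hn 3)) (pt hn 2))
        ((swap i (pt hn 2) * swap j (pt hn 3)) (pt hn 3)) = 6 := by
      intro i hi' j hj hji
      have h1 := (lt_pt_two_iff hn i).1 hi'
      have h2 := (lt_pt_two_iff hn j).1 hj
      simp only [Perm.mul_apply, sB j hj, sA i hi', swap_apply_of_ne_of_ne hji h2.1]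
      simp [pairType, h1, h2]
    -- Expansion of `J J'` as a sum of `(i n-1)(j n)` plus `J s`, with one-based last letters: `j ≠
    -- i` gives type `6`, `j = i` gives type `5`, and `J s` gives type `4`. Solving for the type `6`
    -- entry yields the last weight.
    have key : (T.content (pt hn 2) : ℂ) * (T.content (pt hn 3) *
        (1 : Matrix (StdTableau μ n) (StdTableau μ n) ℂ) T U) =
        ((n : ℂ) - 2) * (((n : ℂ) - 3) * yor μ σ T U +
          yor μ (swap z (pt hn 2) * swap z (pt hn 3)) T U) +
        ((n : ℂ) - 2) * yor μ (swap z (pt hn 2) * adj (lastAdj hn)) T U := by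
      rw [← D1, ← D, J3, mul_add, Matrix.add_apply, J2, Finset.sum_mul, Finset.sum_mul,
        Matrix.sum_apply, Matrix.sum_apply]
      congr 1
      · rw [← card_lt_pt_two hn, ← nsmul_eq_mul, ← Finset.sum_const]
        refine Finset.sum_congr rfl fun i hi' => ?_
        rw [Finset.mul_sum, Matrix.sum_apply]
        have hi2 := (Finset.mem_filter.1 hi').2
        rw [← Finset.add_sum_erase _ _ hi', add_comm]
        congr 1
        · have hcard : (((Finset.univ.filter fun j : Fin n => j < pt hn 2).erase i).card : ℂ) =
              n - 3 := by
            rw [Finset.card_erase_of_mem hi', Nat.cast_sub (Finset.card_pos.2 ⟨i, hi'⟩),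
              card_lt_pt_two]
            ring
          rw [← hcard, ← nsmul_eq_mul, ← Finset.sum_const]
          refine Finset.sum_congr rfl fun j hj => ?_
          obtain ⟨hj1, hj2⟩ := Finset.mem_erase.1 hj
          rw [← yor_mul]
          exact yor_apply_eq_of_pairType hn hT hU
            ((t6 i hi2 j (Finset.mem_filter.1 hj2).2 hj1).trans hσ.symm)
        · rw [← yor_mul]
          exact yor_apply_eq_of_pairType hn hT hU ((t5 i hi2).trans (t5 z h0).symm)
      · rw [← K 4 _ (fun j => swap j (pt hn 2) * adj (lastAdj hn)) (t4 z h0) t4]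
        exact Finset.sum_congr rfl fun j _ => by rw [yor_mul, yor_adj]
    have k4 := H4 _ (t4 z h0)
    have k5 := H5 _ (t5 z h0)
    linear_combination -key + (-1 : ℂ) * k4 - k5

theorem pairType_transversal (a : Fin 7) :
    pairType (pt hn 2) (pt hn 3) (transversal hn a (pt hn 2)) (transversal hn a (pt hn 3)) = a := by
  have h : ∀ i j : Fin 4, (pt hn i = pt hn j) = (i = j) := fun i j => by
    rw [Fin.ext_iff, val_pt, val_pt, Nat.add_left_cancel_iff, Fin.val_inj]
  fin_cases a <;>
    simp [transversal, pairType, swap_apply_def, h]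

end Weights

/-! ### The entries of the spectrum -/

/-- The entry of the spectrum as a sum over pairs of distinct letters. -/
def pairFormula {n : ℕ} (F₁ F₂ F₃ : Fin n → Fin n → ℂ) (a : Fin 7) (w : Fin 7 → ℂ) : ℂ :=
  (∑ x, ∑ y, F₁ x y * (typeSumFormula F₂ x y a / typeCard n a) *
    ∑ c, typeSumFormula F₃ x y c * (w c / typeCard n c)) / ((n : ℂ) * (n - 1)) ^ 2

section Entries

variable {n : ℕ} (hn : 4 ≤ n) {μ : YoungDiagram}

theorem typeCard_ne_zero (hn : 4 ≤ n) (c : Fin 7) : (typeCard n c : ℂ) ≠ 0 := by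
  rw [Nat.cast_ne_zero]
  fin_cases c <;> simp [typeCard] <;> omega

/-- For fixed `g` the sum over `g₂` is grouped by the type of the pair of `g₂` relative to that of
`g`, so it depends only on the pair of `g`. It then serves as a factor of the weight `P` in
`sum_mul_translate`, and the remaining sum over `g` becomes a sum over pairs. -/
theorem sum_sum_mul_yor_apply {F₁ F₂ F₃ : Fin n → Fin n → ℂ} (h₁ : ∀ x, F₁ x x = 0)
    (h₂ : ∀ x, F₂ x x = 0) (h₃ : ∀ x, F₃ x x = 0) (a : Fin 7) {T U : StdTableau μ n}
    (hT : T.IsActive) (hU : U.IsActive) :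
    ∑ g : Perm (Fin n), ∑ g₂ : Perm (Fin n),
      (F₁ (g (pt hn 2)) (g (pt hn 3)) *
          F₂ ((g * transversal hn a) (pt hn 2)) ((g * transversal hn a) (pt hn 3)) *
          F₃ (g₂ (pt hn 2)) (g₂ (pt hn 3)) / (n.factorial : ℂ) ^ 2) * yor μ (g⁻¹ * g₂) T U =
      pairFormula F₁ F₂ F₃ a (typeWeight ((1 : Matrix (StdTableau μ n) (StdTableau μ n) ℂ) T U)
        (yorAdj μ (lastAdj hn) T U) (T.content (pt hn 2)) (T.content (pt hn 3))) := by
  have hne := pt_two_ne_pt_three hn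
  set w := typeWeight ((1 : Matrix (StdTableau μ n) (StdTableau μ n) ℂ) T U)
        (yorAdj μ (lastAdj hn) T U) (T.content (pt hn 2)) (T.content (pt hn 3)) with hw
  have hyor : ∀ σ : Perm (Fin n), ∀ c,
      pairType (pt hn 2) (pt hn 3) (σ (pt hn 2)) (σ (pt hn 3)) = c →
      yor μ σ T U = w c / typeCard n c := fun σ c hσ => by
    rw [eq_div_iff (typeCard_ne_zero hn c), mul_comm, typeCard_mul_yor_apply hn hT hU hσ]
  set Q : Fin n → Fin n → ℂ := fun x y => ∑ c, typeSum F₃ c x y * (w c / typeCard n c) with hQ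
  have hinner : ∀ g : Perm (Fin n),
      ∑ g₂ : Perm (Fin n), F₃ (g₂ (pt hn 2)) (g₂ (pt hn 3)) * yor μ (g⁻¹ * g₂) T U =
        Nat.card (lastTwoStab n) * Q (g (pt hn 2)) (g (pt hn 3)) := by
    intro g
    have e : ∀ g₂ : Perm (Fin n), yor μ (g⁻¹ * g₂) T U =
        w (pairType (g (pt hn 2)) (g (pt hn 3)) (g₂ (pt hn 2)) (g₂ (pt hn 3))) /
          typeCard n (pairType (g (pt hn 2)) (g (pt hn 3)) (g₂ (pt hn 2)) (g₂ (pt hn 3))) := by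
      intro g₂
      refine hyor _ _ ?_
      rw [← pairType_perm g]
      simp only [← Perm.mul_apply, mul_inv_cancel_left]
    simp only [e]
    rw [sum_perm_eq hn (fun x y => F₃ x y * (w (pairType (g (pt hn 2)) (g (pt hn 3)) x y) /
          typeCard n (pairType (g (pt hn 2)) (g (pt hn 3)) x y)))]
    congr 1
    simp only [hQ, typeSum, Finset.sum_mul]
    symm
    rw [Finset.sum_comm]
    refine Finset.sum_congr rfl fun x _ => ?_
    rw [Finset.sum_comm]
    refine Finset.sum_congr rfl fun y _ => ?_
    by_cases hxy : x = y
    · subst hxy; simp [h₃]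
    · simp [hxy, ite_mul]
  have htrans := sum_mul_translate hn (fun x y => F₁ x y * Q x y) F₂ (transversal hn a)
    (pairType_transversal hn a) h₂
  have hcard := card_lastTwoStab_ne_zero (n := n)
  have hfac := factorial_eq_card_mul hn
  have hn0 : (n : ℂ) ≠ 0 := by exact_mod_cast (by omega : n ≠ 0)
  have hn1 : (n : ℂ) - 1 ≠ 0 := by
    rw [sub_ne_zero]; exact_mod_cast (by omega : n ≠ 1)
  calc _ = ∑ g : Perm (Fin n), (F₁ (g (pt hn 2)) (g (pt hn 3)) *
          F₂ ((g * transversal hn a) (pt hn 2)) ((g * transversal hn a) (pt hn 3)) /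
            (n.factorial : ℂ) ^ 2) * ∑ g₂ : Perm (Fin n),
              F₃ (g₂ (pt hn 2)) (g₂ (pt hn 3)) * yor μ (g⁻¹ * g₂) T U := by
        refine Finset.sum_congr rfl fun g _ => ?_
        rw [Finset.mul_sum]
        exact Finset.sum_congr rfl fun g₂ _ => by ring
    _ = (Nat.card (lastTwoStab n) / (n.factorial : ℂ) ^ 2 / typeCard n a) *
          ((typeCard n a : ℂ) * ∑ g : Perm (Fin n),
            F₁ (g (pt hn 2)) (g (pt hn 3)) * Q (g (pt hn 2)) (g (pt hn 3)) *
          F₂ ((g * transversal hn a) (pt hn 2)) ((g * transversal hn a) (pt hn 3))) := by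
        rw [← mul_assoc, div_mul_cancel₀ _ (typeCard_ne_zero hn a), Finset.mul_sum]
        exact Finset.sum_congr rfl fun g _ => by rw [hinner]; ring
    _ = _ := by
        rw [htrans, sum_perm_eq hn (fun x y => F₁ x y * Q x y * typeSum F₂ a x y), hfac,
          pairFormula]
        have : (∑ x, ∑ y, if x = y then 0 else F₁ x y * Q x y * typeSum F₂ a x y) =
            typeCard n a * ∑ x, ∑ y, F₁ x y * (typeSumFormula F₂ x y a / typeCard n a) *
              ∑ c, typeSumFormula F₃ x y c * (w c / typeCard n c) := by
          rw [Finset.mul_sum]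
          refine Finset.sum_congr rfl fun x _ => ?_
          rw [Finset.mul_sum]
          refine Finset.sum_congr rfl fun y _ => ?_
          by_cases hxy : x = y
          · subst hxy; simp [h₁]
          · rw [if_neg hxy, hQ, typeSum_eq h₂ a hxy]
            simp only [typeSum_eq h₃ _ hxy]
            field_simp [typeCard_ne_zero hn a]
        rw [this]
        have := typeCard_ne_zero hn a
        field_simp

/-- The spectrum vanishes outside of the active tableaux. -/
theorem sum_smul_yor_apply_of_not_isActive {u : Perm (Fin n) → ℂ}
    (hu : ∀ g, ∀ h ∈ lastTwoStab n, u (g * h) = u g) {U : StdTableau μ n} (hU : ¬ U.IsActive)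
    (T : StdTableau μ n) : (∑ g, u g • yor μ g) T U = 0 := by
  classical
  -- Right invariance of `u` allows `tau` to be inserted on the right, where it kills the inactive
  -- columns.
  have h1 : (∑ g, u g • yor μ g) = (∑ g, u g • yor μ g) * tau (yor μ) := by
    have h2 : ∀ h ∈ lastTwoStab n, (∑ g, u g • yor μ g) * yor μ h = ∑ g, u g • yor μ g := by
      intro h hh
      rw [Finset.sum_mul, ← Equiv.sum_comp (Equiv.mulRight h) (fun g => u g • yor μ g)]
      refine Finset.sum_congr rfl fun g _ => ?_
      rw [coe_mulRight, hu g h hh, yor_mul, smul_mul_assoc]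
    rw [tau, mul_smul_comm, Finset.mul_sum, Finset.sum_congr rfl fun h hh =>
      h2 h (Finset.mem_filter.1 hh).2, Finset.sum_const, ← Nat.cast_smul_eq_nsmul ℂ, smul_smul,
      ← Fintype.card_subtype, ← Nat.card_eq_fintype_card]
    rw [one_div, inv_mul_cancel₀, one_smul]
    exact card_lastTwoStab_ne_zero
  rw [h1, tau_eq_diagonal, mul_diagonal, if_neg hU, mul_zero]

end Entries

/-! ### The active tableaux of the four shapes -/

section Active

variable {n : ℕ} (hn : 4 ≤ n)

theorem mem_shape (k : Fin 4) (r c : ℕ) : (r, c) ∈ (shape hn k).cells ↔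
    ∃ h : r < (rowLens n k).length, c < (rowLens n k)[r] := by
  rw [YoungDiagram.mem_cells, shape, YoungDiagram.mem_ofRowLens]

theorem mem_shape_zero (r c : ℕ) : (r, c) ∈ (shape hn 0).cells ↔ r = 0 ∧ c < n := by
  rw [mem_shape]
  match r with
  | 0 => simp [rowLens]
  | r + 1 => simp [rowLens]

theorem mem_shape_one (r c : ℕ) :
    (r, c) ∈ (shape hn 1).cells ↔ (r = 0 ∧ c < n - 1) ∨ (r = 1 ∧ c = 0) := by
  rw [mem_shape]
  match r with
  | 0 => simp [rowLens]
  | 1 => simp [rowLens]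
  | r + 2 => simp [rowLens]

theorem mem_shape_two (r c : ℕ) :
    (r, c) ∈ (shape hn 2).cells ↔ (r = 0 ∧ c < n - 2) ∨ (r = 1 ∧ c < 2) := by
  rw [mem_shape]
  match r with
  | 0 => simp [rowLens]
  | 1 => simp [rowLens]
  | r + 2 => simp [rowLens]

theorem mem_shape_three (r c : ℕ) : (r, c) ∈ (shape hn 3).cells ↔
    (r = 0 ∧ c < n - 2) ∨ (r = 1 ∧ c = 0) ∨ (r = 2 ∧ c = 0) := by
  rw [mem_shape]
  match r with
  | 0 => simp [rowLens]
  | 1 => simp [rowLens]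
  | 2 => simp [rowLens]
  | r + 3 => simp [rowLens]

variable {μ : YoungDiagram}

theorem StdTableau.IsActive.cell_eq {T U : StdTableau μ n} (hT : T.IsActive) (hU : U.IsActive)
    {k : Fin n} (hk : (k : ℕ) + 2 < n) : T.1 k = U.1 k :=
  Subtype.ext (Prod.ext ((hT k hk).trans (hU k hk).symm)
    ((hT.col_eq k hk).trans (hU.col_eq k hk).symm))

theorem StdTableau.IsActive.ext {T U : StdTableau μ n} (hT : T.IsActive) (hU : U.IsActive)
    (h2 : T.1 (pt hn 2) = U.1 (pt hn 2)) (h3 : T.1 (pt hn 3) = U.1 (pt hn 3)) : T = U := by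
  refine StdTableau.ext (Equiv.ext fun k => ?_)
  by_cases hk : (k : ℕ) + 2 < n
  · exact hT.cell_eq hU hk
  · rw [ne_pt_iff hn] at hk
    by_cases h : k = pt hn 2
    · rw [h, h2]
    · rw [show k = pt hn 3 by tauto, h3]

theorem StdTableau.IsActive.eq_adj_trans {T U : StdTableau μ n} (hT : T.IsActive)
    (hU : U.IsActive) (h2 : T.1 (pt hn 2) = U.1 (pt hn 3)) (h3 : T.1 (pt hn 3) = U.1 (pt hn 2)) :
    T.1 = (adj (lastAdj hn)).trans U.1 := by
  refine Equiv.ext fun k => ?_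
  rw [trans_apply, adj_lastAdj]
  by_cases hk : (k : ℕ) + 2 < n
  · have := (ne_pt_iff hn k).1 hk
    rw [swap_apply_of_ne_of_ne this.1 this.2]
    exact hT.cell_eq hU hk
  · rw [ne_pt_iff hn] at hk
    by_cases h : k = pt hn 2
    · rw [h, h2, swap_apply_left]
    · rw [show k = pt hn 3 by tauto, h3, swap_apply_right]

theorem StdTableau.IsActive.col_ge {n : ℕ} (hn : 4 ≤ n) {T : StdTableau μ n} (hT : T.IsActive)
    {k : Fin n}
    (hk : n ≤ (k : ℕ) + 2) (hr : T.row k = 0) : n - 2 ≤ (T.1 k).1.2 := by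
  have h1 := hT.col_eq (n - 3) (by omega)
  have h2 := T.col_lt_of_row_eq (j := ⟨n - 3, by omega⟩) (k := k) (by rw [Fin.lt_def]; simp; omega)
    (by rw [hr]; exact hT _ (by simp; omega))
  omega

/-- A cell below the first row can hold only one of the last two letters. This leaves few
possibilities in each shape. -/
theorem StdTableau.IsActive.eq_or_eq {T : StdTableau μ n} (hT : T.IsActive) {r c : ℕ}
    (hmem : (r, c) ∈ μ.cells) (hr : r ≠ 0) :
    (T.1 (pt hn 2)).1 = (r, c) ∨ (T.1 (pt hn 3)).1 = (r, c) := by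
  set k := T.1.symm ⟨(r, c), hmem⟩ with hk
  have e : (T.1 k).1 = (r, c) := by rw [hk, Equiv.apply_symm_apply]
  have h1 : ¬ (k : ℕ) + 2 < n := fun h => hr (by
    have := hT k h
    unfold StdTableau.row at this
    rw [e] at this
    exact this)
  rw [ne_pt_iff hn] at h1
  by_cases h : k = pt hn 2
  · left; rw [← h, e]
  · right; rw [← show k = pt hn 3 by tauto, e]

/-- The cells of the last two letters of an active tableau. -/
theorem StdTableau.IsActive.cells {k : Fin 4} {T : StdTableau (shape hn k) n} (hT : T.IsActive) :
    (k = 0 ∧ (T.1 (pt hn 2)).1 = (0, n - 2) ∧ (T.1 (pt hn 3)).1 = (0, n - 1)) ∨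
    (k = 1 ∧ (T.1 (pt hn 2)).1 = (0, n - 2) ∧ (T.1 (pt hn 3)).1 = (1, 0)) ∨
    (k = 1 ∧ (T.1 (pt hn 2)).1 = (1, 0) ∧ (T.1 (pt hn 3)).1 = (0, n - 2)) ∨
    (k = 2 ∧ (T.1 (pt hn 2)).1 = (1, 0) ∧ (T.1 (pt hn 3)).1 = (1, 1)) ∨
    (k = 3 ∧ (T.1 (pt hn 2)).1 = (1, 0) ∧ (T.1 (pt hn 3)).1 = (2, 0)) := by
  have hlt : pt hn 2 < pt hn 3 := by rw [Fin.lt_def, val_pt, val_pt]; simp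
  have v2 : n ≤ (pt hn 2 : ℕ) + 2 := by rw [val_pt]; change n ≤ n - 4 + 2 + 2; omega
  have v3 : n ≤ (pt hn 3 : ℕ) + 2 := by rw [val_pt]; change n ≤ n - 4 + 3 + 2; omega
  have g2 := hT.col_ge hn v2
  have g3 := hT.col_ge hn v3
  have m2 := (T.1 (pt hn 2)).2
  have m3 := (T.1 (pt hn 3)).2
  have hcl := T.col_lt_of_row_eq hlt
  have st1 := T.isStd.1 (pt hn 3) (pt hn 2)
  have st2 := T.isStd.2 (pt hn 3) (pt hn 2)
  have hq : ∀ r c, (r, c) ∈ (shape hn k).cells → r ≠ 0 → _ :=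
    fun r c h h' => hT.eq_or_eq hn (r := r) (c := c) h h'
  unfold StdTableau.row at g2 g3 hcl
  have hinj : (T.1 (pt hn 2)).1 ≠ (T.1 (pt hn 3)).1 := fun h =>
    hlt.ne (T.1.injective (Subtype.ext h))
  generalize (T.1 (pt hn 2)).1 = p at *
  generalize (T.1 (pt hn 3)).1 = q at *
  obtain ⟨p1, p2⟩ := p
  obtain ⟨q1, q2⟩ := q
  simp only [Prod.mk.injEq, ne_eq] at *
  have hnl : ¬ pt hn 3 < pt hn 2 := hlt.le.not_gt
  fin_cases k <;>
    simp only [Fin.zero_eta, Fin.mk_one, Fin.reduceFinMk] at hq m2 m3 ⊢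
  · rw [mem_shape_zero] at m2 m3
    left
    refine ⟨trivial, ?_⟩
    omega
  · rw [mem_shape_one] at m2 m3
    have := hq 1 0 (by rw [mem_shape_one]; omega) (by omega)
    right
    simp
    omega
  · rw [mem_shape_two] at m2 m3
    have h0 := hq 1 0 (by rw [mem_shape_two]; omega) (by omega)
    have h1 := hq 1 1 (by rw [mem_shape_two]; omega) (by omega)
    simp
    have : ¬ (q1 = p1 ∧ q2 < p2) := fun h => hnl (st1 h.1 h.2)
    omega
  · rw [mem_shape_three] at m2 m3
    have h0 := hq 1 0 (by rw [mem_shape_three]; omega) (by omega)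
    have h1 := hq 2 0 (by rw [mem_shape_three]; omega) (by omega)
    simp
    have : ¬ (q2 = p2 ∧ q1 < p1) := fun h => hnl (st2 h.1 h.2)
    omega

end Active

/-! ### The seven pairs of active tableaux of a common shape -/

/-- The shape of the `q`-th pair of active tableaux and the rows of the last two letters in the
two tableaux. -/
def pairAddress : Fin 7 → List ℕ :=
  ![[0, 0, 0, 0, 0], [1, 0, 1, 0, 1], [1, 1, 0, 1, 0], [1, 0, 1, 1, 0], [1, 1, 0, 0, 1],
    [2, 1, 1, 1, 1], [3, 1, 2, 1, 2]]

/-- The entry of the identity matrix at the `q`-th pair of active tableaux. -/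
def pairDelta : Fin 7 → ℂ := ![1, 1, 1, 0, 0, 1, 1]

/-- The entry of the last adjacent transposition at the `q`-th pair of active tableaux. -/
def pairSwap (n : ℕ) : Fin 7 → ℂ :=
  ![1, -1 / ((n - 1 : ℕ) : ℂ), 1 / ((n - 1 : ℕ) : ℂ),
    ((√(((n - 1) * (n - 1) - 1 : ℕ) : ℝ) : ℝ) : ℂ) / ((n - 1 : ℕ) : ℂ),
    ((√(((n - 1) * (n - 1) - 1 : ℕ) : ℝ) : ℝ) : ℂ) / ((n - 1 : ℕ) : ℂ), 1, -1]

/-- The content of the last letter but one in the first tableau of the `q`-th pair. -/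
def pairContentTwo (n : ℕ) : Fin 7 → ℂ :=
  ![((n - 2 : ℕ) : ℂ), ((n - 2 : ℕ) : ℂ), -1, ((n - 2 : ℕ) : ℂ), -1, -1, -1]

/-- The content of the last letter in the first tableau of the `q`-th pair. -/
def pairContentThree (n : ℕ) : Fin 7 → ℂ :=
  ![((n - 1 : ℕ) : ℂ), -1, ((n - 2 : ℕ) : ℂ), -1, ((n - 2 : ℕ) : ℂ), 0, -2]

section Pairs

variable {n : ℕ} (hn : 4 ≤ n)

/-- The form in which a program can evaluate the constant: it may take square roots of natural
numbers only. -/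
theorem swapCoeff_eq {n : ℕ} (hn : 4 ≤ n) : swapCoeff ((n : ℤ) - 1) =
    ((√(((n - 1) * (n - 1) - 1 : ℕ) : ℝ) : ℝ) : ℂ) / ((n - 1 : ℕ) : ℂ) := by
  have h1 : (1 : ℝ) ≤ (n : ℝ) - 1 := by
    have : (4 : ℝ) ≤ n := by exact_mod_cast hn
    linarith
  have e1 : ((n - 1 : ℕ) : ℝ) = n - 1 := by rw [Nat.cast_sub (by omega)]; simp
  have e2 : (((n - 1) * (n - 1) - 1 : ℕ) : ℝ) = ((n : ℝ) - 1) ^ 2 - 1 := by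
    rw [Nat.cast_sub (Nat.mul_pos (by omega) (by omega)), Nat.cast_mul, e1]; push_cast; ring
  have e3 : (1 : ℝ) - 1 / (((n : ℤ) - 1 : ℤ) : ℝ) ^ 2 =
      (((n : ℝ) - 1) ^ 2 - 1) / ((n : ℝ) - 1) ^ 2 := by
    push_cast
    have : (n : ℝ) - 1 ≠ 0 := by linarith
    field_simp
  rw [swapCoeff, e3, e2, Real.sqrt_div' _ (by positivity), Real.sqrt_sq (by linarith),
    Complex.ofReal_div, ← e1, Complex.ofReal_natCast]

/-- Only the shape `(n-1,1)` has two active tableaux, exchanged by the last adjacent transposition.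
They give four pairs, numbered `1` to `4`; each other shape gives one. -/
theorem exists_pair {k : Fin 4} {T U : StdTableau (shape hn k) n} (hT : T.IsActive)
    (hU : U.IsActive) : ∃ q : Fin 7,
      pairAddress q = [(k : ℕ), T.row (pt hn 2), T.row (pt hn 3), U.row (pt hn 2),
        U.row (pt hn 3)] ∧
      (1 : Matrix (StdTableau (shape hn k) n) (StdTableau (shape hn k) n) ℂ) T U = pairDelta q ∧
      yorAdj (shape hn k) (lastAdj hn) T U = pairSwap n q ∧
      (T.content (pt hn 2) : ℂ) = pairContentTwo n q ∧
      (T.content (pt hn 3) : ℂ) = pairContentThree n q := by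
  have e1 : ((n - 1 : ℕ) : ℂ) = n - 1 := by rw [Nat.cast_sub (by omega)]; simp
  have e2 : ((n - 2 : ℕ) : ℂ) = n - 2 := by rw [Nat.cast_sub (by omega)]; simp
  have z1 : ((n - 1 : ℕ) : ℤ) = n - 1 := by omega
  have z2 : ((n - 2 : ℕ) : ℤ) = n - 2 := by omega
  have hE : T.1 (pt hn 2) = U.1 (pt hn 2) → T.1 (pt hn 3) = U.1 (pt hn 3) → T = U :=
    hT.ext hn hU
  have hN : (T.1 (pt hn 2)).1 ≠ (U.1 (pt hn 2)).1 → T ≠ U := fun h h' => h (by rw [h'])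
  have hS := hT.eq_adj_trans hn hU
  rw [yorAdj_apply, hi_lastAdj, lo_lastAdj, Matrix.one_apply]
  simp only [Subtype.ext_iff] at hE hS
  unfold StdTableau.row StdTableau.content
  rcases hT.cells hn with ⟨rfl, t2, t3⟩ | ⟨rfl, t2, t3⟩ | ⟨rfl, t2, t3⟩ | ⟨rfl, t2, t3⟩ |
      ⟨rfl, t2, t3⟩ <;>
    rcases hU.cells hn with ⟨hk, u2, u3⟩ | ⟨hk, u2, u3⟩ | ⟨hk, u2, u3⟩ | ⟨hk, u2, u3⟩ |
      ⟨hk, u2, u3⟩ <;>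
    first
    | exact absurd hk (by decide)
    | skip
  · refine ⟨0, ?_⟩
    have hTU := hE (by rw [t2, u2]) (by rw [t3, u3])
    rw [if_pos hTU, if_pos hTU, t2, t3, u2, u3]
    simp [pairAddress, pairDelta, pairSwap, pairContentTwo, pairContentThree, z1, z2, e1, e2,
      diagCoeff]
  · refine ⟨1, ?_⟩
    have hTU := hE (by rw [t2, u2]) (by rw [t3, u3])
    rw [if_pos hTU, if_pos hTU, t2, t3, u2, u3]
    simp [pairAddress, pairDelta, pairSwap, pairContentTwo, pairContentThree, z2, e1, e2,
      diagCoeff]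
    rw [← neg_sub, inv_neg, neg_div, one_div]
    ring_nf
  · refine ⟨3, ?_⟩
    have hTU := hN (by rw [t2, u2]; simp)
    rw [if_neg hTU, if_neg hTU, if_pos (hS (by rw [t2, u3]) (by rw [t3, u2])), t2, t3, u2, u3]
    simp [pairAddress, pairDelta, pairSwap, pairContentTwo, pairContentThree, z2, e1, e2]
    rw [← e1, ← swapCoeff_eq hn]
    congr 1
    ring
  · refine ⟨4, ?_⟩
    have hTU := hN (by rw [t2, u2]; simp)
    rw [if_neg hTU, if_neg hTU, if_pos (hS (by rw [t2, u3]) (by rw [t3, u2])), t2, t3, u2, u3]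
    simp [pairAddress, pairDelta, pairSwap, pairContentTwo, pairContentThree, z2, e1, e2]
    rw [← e1, ← swapCoeff_eq hn, ← swapCoeff_neg]
    congr 1
    ring
  · refine ⟨2, ?_⟩
    have hTU := hE (by rw [t2, u2]) (by rw [t3, u3])
    rw [if_pos hTU, if_pos hTU, t2, t3, u2, u3]
    simp [pairAddress, pairDelta, pairSwap, pairContentTwo, pairContentThree, z2, e1, e2,
      diagCoeff]
    ring
  · refine ⟨5, ?_⟩
    have hTU := hE (by rw [t2, u2]) (by rw [t3, u3])
    rw [if_pos hTU, if_pos hTU, t2, t3, u2, u3]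
    simp [pairAddress, pairDelta, pairSwap, pairContentTwo, pairContentThree, e1, e2,
      diagCoeff]
  · refine ⟨6, ?_⟩
    have hTU := hE (by rw [t2, u2]) (by rw [t3, u3])
    rw [if_pos hTU, if_pos hTU, t2, t3, u2, u3]
    simp [pairAddress, pairDelta, pairSwap, pairContentTwo, pairContentThree, e1, e2,
      diagCoeff]

theorem pairAddress_injective : Function.Injective pairAddress := by decide

/-- An active tableau is determined by the rows of the last two letters. -/
theorem StdTableau.IsActive.eq_of_row {k : Fin 4} {T U : StdTableau (shape hn k) n}
    (hT : T.IsActive) (hU : U.IsActive) (h2 : T.row (pt hn 2) = U.row (pt hn 2))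
    (h3 : T.row (pt hn 3) = U.row (pt hn 3)) : T = U := by
  unfold StdTableau.row at h2 h3
  refine hT.ext hn hU (Subtype.ext ?_) (Subtype.ext ?_) <;>
  rcases hT.cells hn with ⟨rfl, t2, t3⟩ | ⟨rfl, t2, t3⟩ | ⟨rfl, t2, t3⟩ | ⟨rfl, t2, t3⟩ |
      ⟨rfl, t2, t3⟩ <;>
    rcases hU.cells hn with ⟨hk, u2, u3⟩ | ⟨hk, u2, u3⟩ | ⟨hk, u2, u3⟩ | ⟨hk, u2, u3⟩ |
      ⟨hk, u2, u3⟩ <;>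
    first
    | exact absurd hk (by decide)
    | simp [t2, u2] at h2; done
    | simp [t2, u2, t3, u3]

end Pairs

/-! ### Reasoning about programs -/

/-- Two memories agree outside of the array `arr`. -/
def AgreeOff (arr : ℕ) (M M' : Memory) : Prop := ∀ b, b ≠ arr → M' b = M b

/-- The expression does not read the array `arr`. -/
def ComplexExp.Avoids (arr : ℕ) : ComplexExp → Prop
  | ofNat _ => True
  | sqrtNat _ => True
  | get b _ => b ≠ arr
  | add x y => x.Avoids arr ∧ y.Avoids arr
  | sub x y => x.Avoids arr ∧ y.Avoids arr
  | mul x y => x.Avoids arr ∧ y.Avoids arr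
  | div x y => x.Avoids arr ∧ y.Avoids arr
  | conj x => x.Avoids arr

theorem ComplexExp.Avoids.eval_eq {arr : ℕ} {M M' : Memory} (h : AgreeOff arr M M')
    (env : ℕ → ℕ) : ∀ {e : ComplexExp}, e.Avoids arr → e.eval env M' = e.eval env M
  | ofNat _, _ => rfl
  | sqrtNat _, _ => rfl
  | get b _, he => by rw [eval, eval, h b he]
  | add _ _, he => by rw [eval, eval, eval_eq h env he.1, eval_eq h env he.2]
  | sub _ _, he => by rw [eval, eval, eval_eq h env he.1, eval_eq h env he.2]
  | mul _ _, he => by rw [eval, eval, eval_eq h env he.1, eval_eq h env he.2]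
  | div _ _, he => by rw [eval, eval, eval_eq h env he.1, eval_eq h env he.2]
  | conj x, he => by rw [eval, eval, eval_eq h env (e := x) he]

/-- In memories that agree with `M` outside of `arr`, the program adds `z` to the cell `l` of
`arr` and does nothing else. -/
def Prog.Adds (P : Prog) (env : ℕ → ℕ) (arr : ℕ) (M : Memory) (l : List ℕ) (z : ℂ) : Prop :=
  ∀ M', AgreeOff arr M M' → (P.run env M').1 =
    Function.update M' arr (Function.update (M' arr) l (M' arr l + z))

/-- Started in memories that agree with `M` outside of `arr`, the program changes only the cells in
`W` of the array `arr`, and gives them values that satisfy `Q`. -/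
def Prog.Writes (P : Prog) (env : ℕ → ℕ) (arr : ℕ) (M : Memory) (W : List ℕ → Prop)
    (Q : List ℕ → ℂ → Prop) : Prop :=
  ∀ M', AgreeOff arr M M' → AgreeOff arr M (P.run env M').1 ∧
    ∀ l, (W l → Q l ((P.run env M').1 arr l)) ∧ (¬ W l → (P.run env M').1 arr l = M' arr l)

theorem AgreeOff.update {arr : ℕ} {M M' : Memory} (h : AgreeOff arr M M') (v : List ℕ → ℂ) :
    AgreeOff arr M (Function.update M' arr v) := fun b hb => by
  rw [Function.update_of_ne hb, h b hb]

theorem Prog.run_forLoop_fst (x : ℕ) (bound : NatExp) (body : Prog) (env : ℕ → ℕ) (M : Memory)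
    (P : ℕ → Memory → Prop) (h0 : P 0 M)
    (hs : ∀ j < bound.eval env, ∀ M', P j M' →
      P (j + 1) (body.run (Function.update env x j) M').1) :
    P (bound.eval env) ((forLoop x bound body).run env M).1 := by
  have : ∀ k ≤ bound.eval env, P k (Nat.rec (motive := fun _ => Memory × ℕ) (M, bound.cost + 1)
        (fun j s =>
          ((body.run (Function.update env x j) s.1).1,
            s.2 + 1 + (body.run (Function.update env x j) s.1).2)) k).1 := by
    intro k
    induction k with
    | zero => exact fun _ => h0
    | succ k ih => exact fun hk => hs k hk _ (ih (by omega))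
  exact this _ le_rfl

theorem Prog.run_forLoop_snd_le {x : ℕ} {bound : NatExp} {body : Prog} {env : ℕ → ℕ} {c v : ℕ}
    (hv : bound.eval env = v) (hc : ∀ j M, (body.run (Function.update env x j) M).2 ≤ c)
    (M : Memory) : ((forLoop x bound body).run env M).2 ≤ bound.cost + 1 + v * (c + 1) := by
  subst hv
  have : ∀ k, (Nat.rec (motive := fun _ => Memory × ℕ) (M, bound.cost + 1)
        (fun j s =>
          ((body.run (Function.update env x j) s.1).1,
            s.2 + 1 + (body.run (Function.update env x j) s.1).2)) k).2 ≤
      bound.cost + 1 + k * (c + 1) := by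
    intro k
    induction k with
    | zero => simp
    | succ k ih =>
      refine (add_le_add (add_le_add_left ih 1) (hc _ _)).trans ?_
      rw [Nat.succ_mul]
      omega
  exact this _

/-- A form suited to nesting: sizes multiply while the overheads add up inside one constant. Sizes
of at least `1` absorb the cost of entering the loop. -/
theorem Prog.run_forLoop_snd_le_mul {x : ℕ} {bound : NatExp} {body : Prog} {env : ℕ → ℕ}
    {v V k : ℕ} (hv : bound.eval env = v) (hv1 : 1 ≤ v) (hV : 1 ≤ V)
    (hc : ∀ j M, (body.run (Function.update env x j) M).2 ≤ V * k) (M : Memory) :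
    ((forLoop x bound body).run env M).2 ≤ v * V * (bound.cost + 2 + k) := by
  refine (run_forLoop_snd_le hv hc M).trans ?_
  have h1 : 1 ≤ v * V := Nat.mul_pos hv1 hV
  have h2 : bound.cost + 1 ≤ v * V * (bound.cost + 1) := Nat.le_mul_of_pos_left _ h1
  have h3 : v * 1 ≤ v * V := Nat.mul_le_mul_left _ hV
  calc _ ≤ v * V * (bound.cost + 1) + (v * V * k + v * V) := by
        rw [mul_add, ← mul_assoc]; omega
    _ = _ := by ring

theorem Prog.Adds.forLoop {x : ℕ} {bound : NatExp} {body : Prog} {env : ℕ → ℕ} {arr : ℕ}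
    {M : Memory} {l : List ℕ} {z : ℕ → ℂ}
    (h : ∀ j < bound.eval env, body.Adds (Function.update env x j) arr M l (z j)) :
    (forLoop x bound body).Adds env arr M l (∑ j ∈ Finset.range (bound.eval env), z j) := by
  intro M' hM'
  refine run_forLoop_fst x bound body env M' (fun k M'' => M'' =
    Function.update M' arr (Function.update (M' arr) l (M' arr l + ∑ j ∈ Finset.range k, z j)))
    (by simp) ?_
  rintro j hj _ rfl
  rw [h j hj _ (hM'.update _), Finset.sum_range_succ]
  simp [add_assoc]

/-- Different passes may write the same cell: `Q` is a condition on a cell and its value, so an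
overwritten value still satisfies it. -/
theorem Prog.Writes.forLoop {x : ℕ} {bound : NatExp} {body : Prog} {env : ℕ → ℕ} {arr : ℕ}
    {M : Memory} {W : ℕ → List ℕ → Prop} {Q : List ℕ → ℂ → Prop}
    (h : ∀ j < bound.eval env, body.Writes (Function.update env x j) arr M (W j) Q) :
    (forLoop x bound body).Writes env arr M (fun l => ∃ j < bound.eval env, W j l) Q := by
  intro M' hM'
  refine run_forLoop_fst x bound body env M' (fun k M'' => AgreeOff arr M M'' ∧
    ∀ l, ((∃ j < k, W j l) → Q l (M'' arr l)) ∧ (¬ (∃ j < k, W j l) → M'' arr l = M' arr l))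
    ⟨hM', by simp⟩ ?_
  rintro j hj M'' ⟨h1, h2⟩
  obtain ⟨h3, h4⟩ := h j hj M'' h1
  refine ⟨h3, fun l => ⟨?_, fun hn => ?_⟩⟩
  · rintro ⟨i, hi, hW⟩
    by_cases hWj : W j l
    · exact (h4 l).1 hWj
    · rw [(h4 l).2 hWj]
      refine (h2 l).1 ⟨i, ?_, hW⟩
      rcases Nat.lt_succ_iff_lt_or_eq.1 hi with h | rfl
      · exact h
      · exact absurd hW hWj
  · rw [(h4 l).2 fun hW => hn ⟨j, Nat.lt_succ_self j, hW⟩]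
    exact (h2 l).2 fun ⟨i, hi, hW⟩ => hn ⟨i, hi.trans (Nat.lt_succ_self j), hW⟩

theorem Prog.Writes.seq {p q : Prog} {env : ℕ → ℕ} {arr : ℕ} {M : Memory} {W₁ W₂ : List ℕ → Prop}
    {Q : List ℕ → ℂ → Prop} (hp : p.Writes env arr M W₁ Q) (hq : q.Writes env arr M W₂ Q) :
    (p.seq q).Writes env arr M (fun l => W₁ l ∨ W₂ l) Q := by
  intro M' hM'
  obtain ⟨h1, h2⟩ := hp M' hM'
  obtain ⟨h3, h4⟩ := hq _ h1
  refine ⟨h3, fun l => ⟨fun hW => ?_, fun hW => ?_⟩⟩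
  · by_cases h : W₂ l
    · exact (h4 l).1 h
    · exact ((h4 l).2 h).symm ▸ (h2 l).1 (hW.resolve_right h)
  · exact ((h4 l).2 fun h => hW (Or.inr h)).trans ((h2 l).2 fun h => hW (Or.inl h))

theorem Prog.Writes.mono {p : Prog} {env : ℕ → ℕ} {arr : ℕ} {M : Memory} {W W' : List ℕ → Prop}
    {Q : List ℕ → ℂ → Prop} (hp : p.Writes env arr M W Q) (h : ∀ l, W l ↔ W' l) :
    p.Writes env arr M W' Q := by
  rwa [show W' = W from funext fun l => propext (h l).symm]

/-! ### Tabulating a sum -/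

/-- The program that sets the cells `pre ++ [x₂, x₃, x₄]` of `arr` to the sum of `e` over the
variables `5` and `6`. -/
def tabulate (arr : ℕ) (pre : List ℕ) (b₂ b₃ b₄ b₅ b₆ : NatExp) (e : ComplexExp) : Prog :=
  let idx := pre.map NatExp.lit ++ [.var 2, .var 3, .var 4]
  .forLoop 2 b₂ <| .forLoop 3 b₃ <| .forLoop 4 b₄ <|
    .seq (.set arr idx (.ofNat (.lit 0)))
      (.forLoop 5 b₅ <| .forLoop 6 b₆ <| .set arr idx (.add (.get arr idx) e))

/-- The values of the variables inside the loops of `tabulate`. -/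
def loopEnv (n d j₂ j₃ j₄ j₅ j₆ : ℕ) : ℕ → ℕ :=
  Function.update (Function.update (Function.update (Function.update (Function.update
    (initEnv n d) 2 j₂) 3 j₃) 4 j₄) 5 j₅) 6 j₆

/-- The expression has the value `v` whenever `n` and `d` stand in the variables `0` and `1`. -/
def NatExp.IsSize (n d : ℕ) (b : NatExp) (v : ℕ) : Prop :=
  ∀ env : ℕ → ℕ, env 0 = n → env 1 = d → b.eval env = v

theorem NatExp.eval_map_lit (pre : List ℕ) (env : ℕ → ℕ) :
    (pre.map NatExp.lit).map (NatExp.eval env) = pre := by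
  induction pre with
  | nil => rfl
  | cons a l ih => rw [List.map_cons, List.map_cons, ih]; rfl

section Tabulate

variable {n d : ℕ} {arr : ℕ} {pre : List ℕ} {b₂ b₃ b₄ b₅ b₆ : NatExp} {v₂ v₃ v₄ v₅ v₆ : ℕ}

/-- Because `e` does not read the array being written, its value stays the one in `M` throughout the
accumulation. -/
theorem writes_tabulate (h₂ : b₂.IsSize n d v₂) (h₃ : b₃.IsSize n d v₃)
    (h₄ : b₄.IsSize n d v₄) (h₅ : b₅.IsSize n d v₅) (h₆ : b₆.IsSize n d v₆)
    {M : Memory} {e : ComplexExp} (he : e.Avoids arr) {Q : List ℕ → ℂ → Prop}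
    (hQ : ∀ j₂ < v₂, ∀ j₃ < v₃, ∀ j₄ < v₄, Q (pre ++ [j₂, j₃, j₄])
      (∑ j₅ ∈ Finset.range v₅, ∑ j₆ ∈ Finset.range v₆, e.eval (loopEnv n d j₂ j₃ j₄ j₅ j₆) M)) :
    (tabulate arr pre b₂ b₃ b₄ b₅ b₆ e).Writes (initEnv n d) arr M
      (fun l => ∃ j₂ < v₂, ∃ j₃ < v₃, ∃ j₄ < v₄, l = pre ++ [j₂, j₃, j₄]) Q := by
  have e2 : b₂.eval (initEnv n d) = v₂ := h₂ _ rfl rfl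
  have key := Prog.Writes.forLoop (x := 2) (bound := b₂) (env := initEnv n d) (arr := arr) (M := M)
    (Q := Q) (W := fun j₂ l => ∃ j₃ < v₃, ∃ j₄ < v₄, l = pre ++ [j₂, j₃, j₄])
    (body := .forLoop 3 b₃ <| .forLoop 4 b₄ <|
      .seq (.set arr (pre.map NatExp.lit ++ [.var 2, .var 3, .var 4]) (.ofNat (.lit 0)))
      (.forLoop 5 b₅ <| .forLoop 6 b₆ <| .set arr (pre.map NatExp.lit ++ [.var 2, .var 3, .var 4])
        (.add (.get arr (pre.map NatExp.lit ++ [.var 2, .var 3, .var 4])) e)))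
  rw [e2] at key
  refine key fun j₂ hj₂ => ?_
  set env2 := Function.update (initEnv n d) 2 j₂ with henv2
  have e3 : b₃.eval env2 = v₃ := h₃ _ rfl rfl
  rw [← e3]
  refine Prog.Writes.forLoop (W := fun j₃ l => ∃ j₄ < v₄, l = pre ++ [j₂, j₃, j₄])
    fun j₃ hj₃ => ?_
  rw [e3] at hj₃
  set env3 := Function.update env2 3 j₃ with henv3
  have e4 : b₄.eval env3 = v₄ := h₄ _ rfl rfl
  rw [← e4]
  refine Prog.Writes.forLoop (W := fun j₄ l => l = pre ++ [j₂, j₃, j₄]) fun j₄ hj₄ => ?_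
  rw [e4] at hj₄
  set env4 := Function.update env3 4 j₄ with henv4
  have hidx : ∀ env : ℕ → ℕ, env 2 = j₂ → env 3 = j₃ → env 4 = j₄ →
      (pre.map NatExp.lit ++ [NatExp.var 2, .var 3, .var 4]).map (NatExp.eval env) =
        pre ++ [j₂, j₃, j₄] := by
    intro env g2 g3 g4
    rw [List.map_append, NatExp.eval_map_lit]
    simp [NatExp.eval, g2, g3, g4]
  have hadd : (Prog.forLoop 5 b₅ <| .forLoop 6 b₆ <|
      .set arr (pre.map NatExp.lit ++ [.var 2, .var 3, .var 4])
        (.add (.get arr (pre.map NatExp.lit ++ [.var 2, .var 3, .var 4])) e)).Adds env4 arr M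
      (pre ++ [j₂, j₃, j₄])
      (∑ j₅ ∈ Finset.range v₅, ∑ j₆ ∈ Finset.range v₆,
        e.eval (loopEnv n d j₂ j₃ j₄ j₅ j₆) M) := by
    have e5 : b₅.eval env4 = v₅ := h₅ _ rfl rfl
    rw [← e5]
    refine Prog.Adds.forLoop fun j₅ _ => ?_
    have e6 : b₆.eval (Function.update env4 5 j₅) = v₆ := h₆ _ rfl rfl
    rw [← e6]
    refine Prog.Adds.forLoop fun j₆ _ => ?_
    intro M' hM'
    rw [Prog.run]
    simp only [ComplexExp.eval]
    rw [hidx _ rfl rfl rfl, he.eval_eq hM']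
    rfl
  intro M' hM'
  rw [Prog.run, hadd _ (by rw [Prog.run]; exact hM'.update _), Prog.run]
  simp only
  rw [hidx _ rfl rfl rfl]
  refine ⟨(hM'.update _).update _, fun l => ⟨?_, fun hl => ?_⟩⟩
  · rintro rfl
    simpa [ComplexExp.eval, NatExp.eval] using hQ j₂ hj₂ j₃ hj₃ j₄ hj₄
  · simp [Function.update_of_ne hl]

theorem run_tabulate_le (h₂ : b₂.IsSize n d v₂) (h₃ : b₃.IsSize n d v₃)
    (h₄ : b₄.IsSize n d v₄) (h₅ : b₅.IsSize n d v₅) (h₆ : b₆.IsSize n d v₆)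
    (p₂ : 1 ≤ v₂) (p₃ : 1 ≤ v₃) (p₄ : 1 ≤ v₄) (p₅ : 1 ≤ v₅)
    (p₆ : 1 ≤ v₆) (e : ComplexExp) (M : Memory) :
    ((tabulate arr pre b₂ b₃ b₄ b₅ b₆ e).run (initEnv n d) M).2 ≤
      v₂ * (v₃ * (v₄ * (v₅ * v₆))) *
        (b₂.cost + b₃.cost + b₄.cost + b₅.cost + b₆.cost + 10 + e.cost +
          (3 * ((pre.map NatExp.lit ++ [NatExp.var 2, .var 3, .var 4]).map NatExp.cost).sum +
            6)) := by
  set idx := pre.map NatExp.lit ++ [NatExp.var 2, .var 3, .var 4] with hidx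
  set s := (idx.map NatExp.cost).sum with hs
  have q6 : 1 ≤ v₅ * v₆ := Nat.mul_pos p₅ p₆
  have q4 : 1 ≤ v₄ * (v₅ * v₆) := Nat.mul_pos p₄ q6
  have q3 : 1 ≤ v₃ * (v₄ * (v₅ * v₆)) := Nat.mul_pos p₃ q4
  have step : ∀ {x y k k' : ℕ}, k ≤ k' → y ≤ x * k → y ≤ x * k' := fun h h' =>
    h'.trans (Nat.mul_le_mul_left _ h)
  refine step (k := b₂.cost + 2 + (b₃.cost + 2 + (b₄.cost + 2 + (b₅.cost + 2 + (b₆.cost + 2 +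
    (s + (s + 1 + e.cost + 1) + 1)) + (s + 3))))) (by omega) ?_
  refine Prog.run_forLoop_snd_le_mul (h₂ _ rfl rfl) p₂ q3 (fun j₂ M => ?_) M
  refine Prog.run_forLoop_snd_le_mul (h₃ _ rfl rfl) p₃ q4 (fun j₃ M => ?_) M
  refine Prog.run_forLoop_snd_le_mul (h₄ _ rfl rfl) p₄ q6 (fun j₄ M => ?_) M
  rw [Prog.run, add_comm, mul_add]
  refine add_le_add ?_ ?_
  · refine Prog.run_forLoop_snd_le_mul (h₅ _ rfl rfl) p₅ p₆ (fun j₅ M => ?_) _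
    rw [← mul_one v₆]
    refine Prog.run_forLoop_snd_le_mul (h₆ _ rfl rfl) p₆ le_rfl (fun j₆ M => ?_) _
    rw [one_mul]
    exact le_rfl
  · refine (Nat.le_mul_of_pos_left _ q6).trans' ?_
    exact le_rfl

end Tabulate

/-- The sequence of the programs of a list. -/
def progList : List Prog → Prog
  | [] => .skip
  | p :: l => .seq p (progList l)

theorem writes_progList {env : ℕ → ℕ} {arr : ℕ} {M : Memory} {Q : List ℕ → ℂ → Prop} {ι : Type*}
    {P : ι → Prog} {W : ι → List ℕ → Prop} (h : ∀ i, (P i).Writes env arr M (W i) Q) :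
    ∀ L : List ι, (progList (L.map P)).Writes env arr M (fun l => ∃ i ∈ L, W i l) Q
  | [] => fun M' hM' => ⟨hM', fun l => ⟨by simp, fun _ => rfl⟩⟩
  | i :: L => ((h i).seq (writes_progList h L)).mono (by simp)

theorem run_progList_le {ι : Type*} {P : ι → Prog} {c : ι → ℕ} {env : ℕ → ℕ} {B : ℕ}
    (hB : 1 ≤ B) (h : ∀ i M, ((P i).run env M).2 ≤ B * c i) (L : List ι) :
    ∀ M, ((progList (L.map P)).run env M).2 ≤ B * ((L.map c).sum + 1) := by
  induction L with
  | nil =>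
    intro M
    change 1 ≤ B * (0 + 1)
    omega
  | cons i L ih =>
    intro M
    have h1 := h i M
    have h2 := ih ((P i).run env M).1
    rw [List.map_cons, List.map_cons, List.sum_cons, add_assoc, mul_add]
    exact add_le_add h1 h2

/-! ### The program -/

/-- An index expression with the value `0` if `x` and `y` have the same value, and `1` otherwise. -/
def maskExp (x y : NatExp) : NatExp :=
  .sub (.lit 1) (.sub (.lit 1) (.add (.sub x y) (.sub y x)))

/-- The input at `[i, x, y]`, with zeros on the diagonal. -/
def inputExp (i x y : NatExp) : ComplexExp := .mul (.ofNat (maskExp x y)) (.get 0 [i, x, y])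

/-- The sums of the input over the pairs of a type, in terms of the row sums in array `2`, the
column sums in array `3` and the totals in array `4`. -/
def typeSumExp (i x y : NatExp) : Fin 7 → ComplexExp :=
  ![inputExp i x y, inputExp i y x,
    .sub (.get 3 [i, y, .lit 0]) (inputExp i x y), .sub (.get 2 [i, x, .lit 0]) (inputExp i x y),
    .sub (.get 2 [i, y, .lit 0]) (inputExp i y x), .sub (.get 3 [i, x, .lit 0]) (inputExp i y x),
    .add (.add (.sub (.sub (.sub (.sub (.get 4 [i, .lit 0, .lit 0])
      (.get 2 [i, x, .lit 0])) (.get 2 [i, y, .lit 0])) (.get 3 [i, x, .lit 0]))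
      (.get 3 [i, y, .lit 0])) (inputExp i x y)) (inputExp i y x)]

/-- The expression `n - c`. -/
def nSub (c : ℕ) : NatExp := .sub (.var 0) (.lit c)

/-- The negative of a natural number. -/
def negExp (c : ℕ) : ComplexExp := .sub (.ofNat (.lit 0)) (.ofNat (.lit c))

/-- Expressions for `typeCard`. -/
def typeCardExp : Fin 7 → ComplexExp :=
  ![.ofNat (.lit 1), .ofNat (.lit 1), .ofNat (nSub 2), .ofNat (nSub 2), .ofNat (nSub 2),
    .ofNat (nSub 2), .ofNat (.mul (nSub 2) (nSub 3))]

/-- Expressions for `pairDelta`. -/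
def pairDeltaExp : Fin 7 → ComplexExp :=
  ![.ofNat (.lit 1), .ofNat (.lit 1), .ofNat (.lit 1), .ofNat (.lit 0), .ofNat (.lit 0),
    .ofNat (.lit 1), .ofNat (.lit 1)]

/-- Expressions for `pairSwap`. -/
def pairSwapExp : Fin 7 → ComplexExp :=
  ![.ofNat (.lit 1), .div (negExp 1) (.ofNat (nSub 1)), .div (.ofNat (.lit 1)) (.ofNat (nSub 1)),
    .div (.sqrtNat (.sub (.mul (nSub 1) (nSub 1)) (.lit 1))) (.ofNat (nSub 1)),
    .div (.sqrtNat (.sub (.mul (nSub 1) (nSub 1)) (.lit 1))) (.ofNat (nSub 1)),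
    .ofNat (.lit 1), negExp 1]

/-- Expressions for `pairContentTwo`. -/
def pairContentTwoExp : Fin 7 → ComplexExp :=
  ![.ofNat (nSub 2), .ofNat (nSub 2), negExp 1, .ofNat (nSub 2), negExp 1, negExp 1, negExp 1]

/-- Expressions for `pairContentThree`. -/
def pairContentThreeExp : Fin 7 → ComplexExp :=
  ![.ofNat (nSub 1), negExp 1, .ofNat (nSub 2), negExp 1, .ofNat (nSub 2), .ofNat (.lit 0),
    negExp 2]

/-- Expressions for `typeWeight`. -/
def typeWeightExp (δ s α β : ComplexExp) : Fin 7 → ComplexExp :=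
  ![δ, s, .mul α δ, .sub (.mul β δ) s, .mul α s, .sub (.mul β s) δ,
    .sub (.mul (.add (.mul α β) (.ofNat (.lit 1))) δ) (.mul (.add α β) s)]

/-- The sum of seven expressions. -/
def sumExp (e : Fin 7 → ComplexExp) : ComplexExp :=
  .add (.add (.add (.add (.add (.add (e 0) (e 1)) (e 2)) (e 3)) (e 4)) (e 5)) (e 6)

/-- Complex conjugation, if the convention asks for it. -/
def Convention.exp : Convention → ComplexExp → ComplexExp
  | plain, e => e
  | conjugated, e => .conj e

/-- Complex conjugation, if the convention asks for it. -/
def Convention.val : Convention → ℂ → ℂ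
  | plain, z => z
  | conjugated, z => star z

/-- The summand of `pairFormula`, for the orbit indices in the variables `2`, `3`, `4` and the pair
of letters in the variables `5` and `6`. -/
def entryExp (conv : Convention) (a q : Fin 7) : ComplexExp :=
  .div (.mul (.mul (conv.exp (inputExp (.var 2) (.var 5) (.var 6)))
      (.div (conv.exp (typeSumExp (.var 3) (.var 5) (.var 6) a)) (typeCardExp a)))
    (sumExp fun c => .mul (typeSumExp (.var 4) (.var 5) (.var 6) c)
      (.div (typeWeightExp (pairDeltaExp q) (pairSwapExp q) (pairContentTwoExp q)
        (pairContentThreeExp q) c) (typeCardExp c))))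
    (.mul (.ofNat (.mul (.var 0) (nSub 1))) (.ofNat (.mul (.var 0) (nSub 1))))

/-- Row sums of the input. -/
def rowProg : Prog := tabulate 2 [] (.var 1) (.var 0) (.lit 1) (.var 0) (.lit 1)
  (inputExp (.var 2) (.var 3) (.var 5))

/-- Column sums of the input. -/
def colProg : Prog := tabulate 3 [] (.var 1) (.var 0) (.lit 1) (.var 0) (.lit 1)
  (inputExp (.var 2) (.var 5) (.var 3))

/-- Totals of the input. -/
def totalProg : Prog := tabulate 4 [] (.var 1) (.lit 1) (.lit 1) (.var 0) (.var 0)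
  (inputExp (.var 2) (.var 5) (.var 6))

/-- The entries of the spectrum at one group element and one pair of active tableaux. -/
def entryProg (conv : Convention) (p : Fin 7 × Fin 7) : Prog :=
  tabulate 1 ((p.1 : ℕ) :: pairAddress p.2) (.var 1) (.var 1) (.var 1) (.var 0) (.var 0)
    (entryExp conv p.1 p.2)

/-- The program that computes the reduced Multi-Orbit Skew Spectrum. -/
def spectrumProg (conv : Convention) : Prog :=
  .seq rowProg (.seq colProg (.seq totalProg
    (progList (((List.finRange 7).product (List.finRange 7)).map (entryProg conv)))))

/-! ### Values of the expressions and the arrays they read -/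

/-- The input table with zeros on the diagonal. -/
def maskedInput (M : Memory) (i x y : ℕ) : ℂ := if x = y then 0 else M 0 [i, x, y]

/-- `HoldsInput` leaves the diagonal cells arbitrary, so the mask removes them. With truncated
subtraction `|x - y|` is `(x - y) + (y - x)`, and `1 - (1 - m)` is `0` for `m = 0` and `1`
otherwise. -/
theorem eval_inputExp (env : ℕ → ℕ) (M : Memory) (i x y : NatExp) :
    (inputExp i x y).eval env M = maskedInput M (i.eval env) (x.eval env) (y.eval env) := by
  simp only [inputExp, maskExp, ComplexExp.eval, NatExp.eval, maskedInput, List.map_cons,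
    List.map_nil]
  split_ifs with h
  · rw [h]; simp
  · rw [show 1 - (1 - (x.eval env - y.eval env + (y.eval env - x.eval env))) = 1 by omega]
    simp

/-- The tables of row sums, column sums and totals are correct. -/
structure HoldsSums (n d : ℕ) (M : Memory) : Prop where
  row : ∀ i < d, ∀ x < n, M 2 [i, x, 0] = ∑ y : Fin n, maskedInput M i x y
  col : ∀ i < d, ∀ y < n, M 3 [i, y, 0] = ∑ x : Fin n, maskedInput M i x y
  total : ∀ i < d, M 4 [i, 0, 0] = ∑ x : Fin n, ∑ y : Fin n, maskedInput M i x y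

theorem eval_typeSumExp {n d : ℕ} {M : Memory} (hM : HoldsSums n d M) (env : ℕ → ℕ)
    {i x y : NatExp} (hi : i.eval env < d) (u v : Fin n) (hu : x.eval env = u)
    (hv : y.eval env = v) (c : Fin 7) :
    (typeSumExp i x y c).eval env M =
      typeSumFormula (fun u v => maskedInput M (i.eval env) u v) u v c := by
  have h1 := hM.row _ hi u u.2
  have h2 := hM.row _ hi v v.2
  have h3 := hM.col _ hi u u.2
  have h4 := hM.col _ hi v v.2
  have h5 := hM.total _ hi
  fin_cases c <;>
    simp [typeSumExp, typeSumFormula, ComplexExp.eval, NatExp.eval, eval_inputExp, hu, hv, h1, h2,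
      h3, h4, h5]

theorem eval_typeCardExp {n : ℕ} {env : ℕ → ℕ} (henv : env 0 = n) (M : Memory) (c : Fin 7) :
    (typeCardExp c).eval env M = typeCard n c := by
  fin_cases c <;> simp [typeCardExp, typeCard, ComplexExp.eval, NatExp.eval, nSub, henv]

theorem eval_pairDeltaExp (env : ℕ → ℕ) (M : Memory) (q : Fin 7) :
    (pairDeltaExp q).eval env M = pairDelta q := by
  fin_cases q <;> simp [pairDeltaExp, pairDelta, ComplexExp.eval, NatExp.eval]

theorem eval_pairSwapExp {n : ℕ} {env : ℕ → ℕ} (henv : env 0 = n) (M : Memory) (q : Fin 7) :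
    (pairSwapExp q).eval env M = pairSwap n q := by
  fin_cases q <;> simp [pairSwapExp, pairSwap, ComplexExp.eval, NatExp.eval, nSub, negExp, henv]

theorem eval_pairContentTwoExp {n : ℕ} {env : ℕ → ℕ} (henv : env 0 = n) (M : Memory) (q : Fin 7) :
    (pairContentTwoExp q).eval env M = pairContentTwo n q := by
  fin_cases q <;>
    simp [pairContentTwoExp, pairContentTwo, ComplexExp.eval, NatExp.eval, nSub, negExp, henv]

theorem eval_pairContentThreeExp {n : ℕ} {env : ℕ → ℕ} (henv : env 0 = n) (M : Memory)
    (q : Fin 7) : (pairContentThreeExp q).eval env M = pairContentThree n q := by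
  fin_cases q <;>
    simp [pairContentThreeExp, pairContentThree, ComplexExp.eval, NatExp.eval, nSub, negExp, henv]

theorem eval_typeWeightExp (env : ℕ → ℕ) (M : Memory) (δ s α β : ComplexExp) (c : Fin 7) :
    (typeWeightExp δ s α β c).eval env M =
      typeWeight (δ.eval env M) (s.eval env M) (α.eval env M) (β.eval env M) c := by
  fin_cases c <;> simp [typeWeightExp, typeWeight, ComplexExp.eval, NatExp.eval]

theorem eval_sumExp (env : ℕ → ℕ) (M : Memory) (e : Fin 7 → ComplexExp) :
    (sumExp e).eval env M = ∑ c, (e c).eval env M := by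
  rw [Fin.sum_univ_seven]
  rfl

theorem Convention.eval_exp (conv : Convention) (env : ℕ → ℕ) (M : Memory) (e : ComplexExp) :
    (conv.exp e).eval env M = conv.val (e.eval env M) := by
  cases conv <;> rfl

theorem Convention.val_typeSumFormula (conv : Convention) {n : ℕ} (F : Fin n → Fin n → ℂ)
    (u v : Fin n) (c : Fin 7) :
    conv.val (typeSumFormula F u v c) = typeSumFormula (fun x y => conv.val (F x y)) u v c := by
  cases conv
  · rfl
  · fin_cases c <;> simp [Convention.val, typeSumFormula]

/-- The normalizing division of `pairFormula` is done in each summand, so that the program is a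
plain accumulation. -/
theorem sum_eval_entryExp {n d : ℕ} (hn : 4 ≤ n) {M : Memory} (hM : HoldsSums n d M)
    (conv : Convention) (a q : Fin 7) {i₁ i₂ i₃ : ℕ} (h₂ : i₂ < d) (h₃ : i₃ < d) :
    ∑ x ∈ Finset.range n, ∑ y ∈ Finset.range n,
        (entryExp conv a q).eval (loopEnv n d i₁ i₂ i₃ x y) M =
      pairFormula (fun x y : Fin n => conv.val (maskedInput M i₁ x y))
        (fun x y => conv.val (maskedInput M i₂ x y)) (fun x y => maskedInput M i₃ x y) a
        (typeWeight (pairDelta q) (pairSwap n q) (pairContentTwo n q) (pairContentThree n q)) := by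
  rw [pairFormula, Finset.sum_range, Finset.sum_div]
  refine Finset.sum_congr rfl fun x _ => ?_
  rw [Finset.sum_range, Finset.sum_div]
  refine Finset.sum_congr rfl fun y _ => ?_
  have henv : loopEnv n d i₁ i₂ i₃ x y 0 = n := rfl
  have e1 : ((n - 1 : ℕ) : ℂ) = n - 1 := by rw [Nat.cast_sub (by omega)]; simp
  have E2 := eval_typeSumExp hM (loopEnv n d i₁ i₂ i₃ x y) (i := .var 3) (x := .var 5)
    (y := .var 6) h₂ x y rfl rfl
  have E3 := eval_typeSumExp hM (loopEnv n d i₁ i₂ i₃ x y) (i := .var 4) (x := .var 5)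
    (y := .var 6) h₃ x y rfl rfl
  simp only [entryExp, ComplexExp.eval, Convention.eval_exp, eval_sumExp, E2, E3,
    eval_typeCardExp henv, eval_typeWeightExp, eval_pairDeltaExp, eval_pairSwapExp henv,
    eval_pairContentTwoExp henv, eval_pairContentThreeExp henv, Convention.val_typeSumFormula,
    eval_inputExp]
  rw [pow_two]
  simp only [NatExp.eval, nSub, henv, Nat.cast_mul, e1]
  rfl

theorem Convention.avoids_exp (conv : Convention) {arr : ℕ} {e : ComplexExp} (h : e.Avoids arr) :
    (conv.exp e).Avoids arr := by
  cases conv <;> exact h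

theorem avoids_typeSumExp (i x y : NatExp) (c : Fin 7) : (typeSumExp i x y c).Avoids 1 := by
  fin_cases c <;> simp [typeSumExp, inputExp, ComplexExp.Avoids]

theorem avoids_entryExp (conv : Convention) (a q : Fin 7) : (entryExp conv a q).Avoids 1 := by
  have hc : ∀ c, (typeCardExp c).Avoids 1 := by
    intro c; fin_cases c <;> simp [typeCardExp, ComplexExp.Avoids]
  have hd : (pairDeltaExp q).Avoids 1 := by
    fin_cases q <;> simp [pairDeltaExp, ComplexExp.Avoids]
  have hs : (pairSwapExp q).Avoids 1 := by
    fin_cases q <;> simp [pairSwapExp, negExp, ComplexExp.Avoids]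
  have h2 : (pairContentTwoExp q).Avoids 1 := by
    fin_cases q <;> simp [pairContentTwoExp, negExp, ComplexExp.Avoids]
  have h3 : (pairContentThreeExp q).Avoids 1 := by
    fin_cases q <;> simp [pairContentThreeExp, negExp, ComplexExp.Avoids]
  have hw : ∀ c, (typeWeightExp (pairDeltaExp q) (pairSwapExp q) (pairContentTwoExp q)
      (pairContentThreeExp q) c).Avoids 1 := by
    intro c; fin_cases c <;> simp [typeWeightExp, ComplexExp.Avoids, hd, hs, h2, h3]
  have hi : (inputExp (.var 2) (.var 5) (.var 6)).Avoids 1 := by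
    simp [inputExp, ComplexExp.Avoids]
  simp [entryExp, sumExp, ComplexExp.Avoids, hc, hw, avoids_typeSumExp, conv.avoids_exp hi,
    conv.avoids_exp (avoids_typeSumExp _ _ _ _)]

theorem isSize_var_zero (n d : ℕ) : (NatExp.var 0).IsSize n d n := fun _ h _ => h

theorem isSize_var_one (n d : ℕ) : (NatExp.var 1).IsSize n d d := fun _ _ h => h

theorem isSize_lit (n d c : ℕ) : (NatExp.lit c).IsSize n d c := fun _ _ _ => rfl

/-! ### Running time and correctness of the whole program -/

/-- The number of steps of the program is at most a constant multiple of `d ^ 3 * n ^ 2`. -/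
theorem exists_run_spectrumProg_le (conv : Convention) : ∃ C : ℕ, ∀ n d : ℕ, 1 ≤ n → 1 ≤ d →
    ∀ M, ((spectrumProg conv).run (initEnv n d) M).2 ≤ C * (d ^ 3 * n ^ 2) := by
  have hrow : ∃ C : ℕ, ∀ n d : ℕ, 1 ≤ n → 1 ≤ d →
      ∀ M, (rowProg.run (initEnv n d) M).2 ≤ d ^ 3 * n ^ 2 * C := by
    refine ⟨_, fun n d hn hd M => (run_tabulate_le (isSize_var_one n d) (isSize_var_zero n d)
      (isSize_lit n d 1) (isSize_var_zero n d) (isSize_lit n d 1) hd hn le_rfl hn le_rfl _ M).trans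
      (Nat.mul_le_mul_right _ ?_)⟩
    calc _ = d * n ^ 2 := by ring
      _ ≤ _ := Nat.mul_le_mul_right _ (Nat.le_self_pow (by norm_num) d)
  have hcol : ∃ C : ℕ, ∀ n d : ℕ, 1 ≤ n → 1 ≤ d →
      ∀ M, (colProg.run (initEnv n d) M).2 ≤ d ^ 3 * n ^ 2 * C := by
    refine ⟨_, fun n d hn hd M => (run_tabulate_le (isSize_var_one n d) (isSize_var_zero n d)
      (isSize_lit n d 1) (isSize_var_zero n d) (isSize_lit n d 1) hd hn le_rfl hn le_rfl _ M).trans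
      (Nat.mul_le_mul_right _ ?_)⟩
    calc _ = d * n ^ 2 := by ring
      _ ≤ _ := Nat.mul_le_mul_right _ (Nat.le_self_pow (by norm_num) d)
  have htot : ∃ C : ℕ, ∀ n d : ℕ, 1 ≤ n → 1 ≤ d →
      ∀ M, (totalProg.run (initEnv n d) M).2 ≤ d ^ 3 * n ^ 2 * C := by
    refine ⟨_, fun n d hn hd M => (run_tabulate_le (isSize_var_one n d) (isSize_lit n d 1)
      (isSize_lit n d 1) (isSize_var_zero n d) (isSize_var_zero n d) hd le_rfl le_rfl hn hn _
      M).trans (Nat.mul_le_mul_right _ ?_)⟩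
    calc _ = d * n ^ 2 := by ring
      _ ≤ _ := Nat.mul_le_mul_right _ (Nat.le_self_pow (by norm_num) d)
  have hent : ∀ p, ∃ C : ℕ, ∀ n d : ℕ, 1 ≤ n → 1 ≤ d →
      ∀ M, ((entryProg conv p).run (initEnv n d) M).2 ≤ d ^ 3 * n ^ 2 * C := by
    intro p
    refine ⟨_, fun n d hn hd M => (run_tabulate_le (isSize_var_one n d) (isSize_var_one n d)
      (isSize_var_one n d) (isSize_var_zero n d) (isSize_var_zero n d) hd hd hd hn hn _
      M).trans (Nat.mul_le_mul_right _ ?_)⟩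
    exact le_of_eq (by ring)
  obtain ⟨c₁, h₁⟩ := hrow
  obtain ⟨c₂, h₂⟩ := hcol
  obtain ⟨c₃, h₃⟩ := htot
  choose c h using hent
  refine ⟨c₁ + (c₂ + (c₃ + ((((List.finRange 7).product (List.finRange 7)).map c).sum + 1))),
    fun n d hn hd M => ?_⟩
  rw [mul_comm, mul_add, mul_add, mul_add]
  have hpos : 1 ≤ d ^ 3 * n ^ 2 := Nat.mul_pos (Nat.pow_pos hd) (Nat.pow_pos hn)
  exact add_le_add (h₁ n d hn hd _) (add_le_add (h₂ n d hn hd _) (add_le_add (h₃ n d hn hd _)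
    (run_progList_le hpos (fun p M => h p n d hn hd M) _ _)))

/-- The program writes the values of `pairFormula`. -/
theorem run_spectrumProg {n d : ℕ} (hn : 4 ≤ n) (conv : Convention) (M : Memory)
    (a q : Fin 7) {i₁ i₂ i₃ : ℕ} (h₁ : i₁ < d) (h₂ : i₂ < d) (h₃ : i₃ < d) :
    ((spectrumProg conv).run (initEnv n d) M).1 1
        ((a : ℕ) :: pairAddress q ++ [i₁, i₂, i₃]) =
      pairFormula (fun x y : Fin n => conv.val (maskedInput M i₁ x y))
        (fun x y => conv.val (maskedInput M i₂ x y)) (fun x y => maskedInput M i₃ x y) a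
        (typeWeight (pairDelta q) (pairSwap n q) (pairContentTwo n q) (pairContentThree n q)) := by
  have av : ∀ i x y arr, arr ≠ 0 → (inputExp i x y).Avoids arr := fun i x y arr h => by
    simp [inputExp, ComplexExp.Avoids, h.symm]
  set M₁ := (rowProg.run (initEnv n d) M).1 with hM₁
  set M₂ := (colProg.run (initEnv n d) M₁).1 with hM₂
  set M₃ := (totalProg.run (initEnv n d) M₂).1 with hM₃
  have R := writes_tabulate (isSize_var_one n d) (isSize_var_zero n d) (isSize_lit n d 1)
    (isSize_var_zero n d) (isSize_lit n d 1) (arr := 2) (pre := []) (M := M)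
    (av (.var 2) (.var 3) (.var 5) 2 (by decide))
    (Q := fun l z => ∀ i x : ℕ, l = [i, x, 0] → z = ∑ y : Fin n, maskedInput M i x y)
    (by
      intro i _ x _ k hk i' x' h
      simp only [List.nil_append, List.cons.injEq] at h
      obtain ⟨rfl, rfl, -⟩ := h
      simp only [eval_inputExp, Finset.sum_range]
      simp [loopEnv, NatExp.eval]) M (fun _ _ => rfl)
  change AgreeOff 2 M M₁ ∧ _ at R
  have C := writes_tabulate (isSize_var_one n d) (isSize_var_zero n d) (isSize_lit n d 1)
    (isSize_var_zero n d) (isSize_lit n d 1) (arr := 3) (pre := []) (M := M₁)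
    (av (.var 2) (.var 5) (.var 3) 3 (by decide))
    (Q := fun l z => ∀ i y : ℕ, l = [i, y, 0] → z = ∑ x : Fin n, maskedInput M₁ i x y)
    (by
      intro i _ x _ k hk i' x' h
      simp only [List.nil_append, List.cons.injEq] at h
      obtain ⟨rfl, rfl, -⟩ := h
      simp only [eval_inputExp, Finset.sum_range]
      simp [loopEnv, NatExp.eval]) M₁ (fun _ _ => rfl)
  change AgreeOff 3 M₁ M₂ ∧ _ at C
  have T := writes_tabulate (isSize_var_one n d) (isSize_lit n d 1) (isSize_lit n d 1)
    (isSize_var_zero n d) (isSize_var_zero n d) (arr := 4) (pre := []) (M := M₂)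
    (av (.var 2) (.var 5) (.var 6) 4 (by decide))
    (Q := fun l z => ∀ i : ℕ, l = [i, 0, 0] →
      z = ∑ x : Fin n, ∑ y : Fin n, maskedInput M₂ i x y)
    (by
      intro i _ x _ k hk i' h
      simp only [List.nil_append, List.cons.injEq] at h
      obtain ⟨rfl, -⟩ := h
      simp only [eval_inputExp, Finset.sum_range]
      simp [loopEnv, NatExp.eval]) M₂ (fun _ _ => rfl)
  change AgreeOff 4 M₂ M₃ ∧ _ at T
  have z1 : M₁ 0 = M 0 := R.1 0 (by decide)
  have z2 : M₂ 0 = M 0 := (C.1 0 (by decide)).trans z1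
  have z3 : M₃ 0 = M 0 := (T.1 0 (by decide)).trans z2
  have g1 : maskedInput M₁ = maskedInput M := by unfold maskedInput; rw [z1]
  have g2 : maskedInput M₂ = maskedInput M := by unfold maskedInput; rw [z2]
  have g3 : maskedInput M₃ = maskedInput M := by unfold maskedInput; rw [z3]
  have hS : HoldsSums n d M₃ := by
    refine ⟨fun i hi x hx => ?_, fun i hi y hy => ?_, fun i hi => ?_⟩
    · rw [T.1 2 (by decide), C.1 2 (by decide), g3]
      exact (R.2 [i, x, 0]).1 ⟨i, hi, x, hx, 0, by decide, rfl⟩ i x rfl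
    · rw [T.1 3 (by decide), g3, ← g1]
      exact (C.2 [i, y, 0]).1 ⟨i, hi, y, hy, 0, by decide, rfl⟩ i y rfl
    · rw [g3, ← g2]
      exact (T.2 [i, 0, 0]).1 ⟨i, hi, 0, by decide, 0, by decide, rfl⟩ i rfl
  -- Different entries have different addresses, so the condition imposed on a cell concerns one
  -- entry only, and a later table cannot spoil an earlier one.
  have hinj : ∀ (a a' q q' : Fin 7) (i i' j j' k k' : ℕ),
      (a : ℕ) :: pairAddress q ++ [i, j, k] = (a' : ℕ) :: pairAddress q' ++ [i', j', k'] →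
      a = a' ∧ q = q' ∧ i = i' ∧ j = j' ∧ k = k' := by
    intro a a' q q' i i' j j' k k' h
    obtain ⟨h1, h2⟩ := List.append_inj' h rfl
    simp only [List.cons.injEq, and_true] at h1 h2
    exact ⟨Fin.ext h1.1, pairAddress_injective h1.2, h2⟩
  have E := writes_progList (env := initEnv n d) (arr := 1) (M := M₃) (P := entryProg conv)
    (W := fun p l => ∃ j₂ < d, ∃ j₃ < d, ∃ j₄ < d,
      l = (p.1 : ℕ) :: pairAddress p.2 ++ [j₂, j₃, j₄])
    (Q := fun l z => ∀ (a q : Fin 7) (i₁ i₂ i₃ : ℕ),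
      l = (a : ℕ) :: pairAddress q ++ [i₁, i₂, i₃] → z =
      pairFormula (fun x y : Fin n => conv.val (maskedInput M₃ i₁ x y))
        (fun x y => conv.val (maskedInput M₃ i₂ x y)) (fun x y => maskedInput M₃ i₃ x y) a
        (typeWeight (pairDelta q) (pairSwap n q) (pairContentTwo n q) (pairContentThree n q)))
    (fun p => writes_tabulate (isSize_var_one n d) (isSize_var_one n d) (isSize_var_one n d)
      (isSize_var_zero n d) (isSize_var_zero n d) (avoids_entryExp conv p.1 p.2) (by
        intro j₂ _ j₃ hj₃ j₄ hj₄ a q i₁ i₂ i₃ h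
        obtain ⟨rfl, rfl, rfl, rfl, rfl⟩ := hinj _ _ _ _ _ _ _ _ _ _ h
        exact sum_eval_entryExp hn hS conv _ _ hj₃ hj₄))
    ((List.finRange 7).product (List.finRange 7)) M₃ (fun _ _ => rfl)
  have := (E.2 ((a : ℕ) :: pairAddress q ++ [i₁, i₂, i₃])).1
    ⟨(a, q), List.mem_product.2 ⟨List.mem_finRange a, List.mem_finRange q⟩,
      i₁, h₁, i₂, h₂, i₃, h₃, rfl⟩
    a q i₁ i₂ i₃ rfl
  rw [g3] at this
  exact this

/-! ### The main theorem -/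

section Main

variable {n d : ℕ} (hn : 4 ≤ n)

theorem quotient_mk_mul (g : Perm (Fin n)) {h : Perm (Fin n)} (hh : h ∈ lastTwoStab n) :
    ((g * h : Perm (Fin n)) : Perm (Fin n) ⧸ lastTwoStab n) = g := by
  rw [QuotientGroup.mk_mul_of_mem g hh]

/-- Both conventions in one formula. -/
theorem reducedEntry_eq_sum (μ : YoungDiagram) (conv : Convention)
    (f : Perm (Fin n) ⧸ lastTwoStab n → Fin d → ℂ) (g₁ : Perm (Fin n)) (i : Fin 3 → Fin d) :
    reducedEntry conv f (yor μ) g₁ i = (tau (yor μ))ᴴ *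
      ∑ g : Perm (Fin n), ∑ g₂ : Perm (Fin n),
        (conv.val (f g (i 0)) * conv.val (f ↑(g * g₁) (i 1)) * f g₂ (i 2) /
          (n.factorial : ℂ) ^ 2) • yor μ (g⁻¹ * g₂) := by
  cases conv with
  | plain =>
    simp only [reducedEntry, Convention.val, Finset.mul_sum]
    refine Finset.sum_congr rfl fun g _ => Finset.sum_congr rfl fun g₂ _ => ?_
    rw [mul_smul_comm, Matrix.mul_assoc, yor_conjTranspose, ← yor_mul]
  | conjugated =>
    simp only [reducedEntry, Convention.val, fourier]
    rw [conjTranspose_mul, Matrix.mul_assoc]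
    refine congrArg _ ?_
    rw [conjTranspose_smul, conjTranspose_sum, smul_mul_smul_comm, Finset.sum_mul,
      Finset.smul_sum]
    refine Finset.sum_congr rfl fun g _ => ?_
    rw [Finset.mul_sum, Finset.smul_sum]
    refine Finset.sum_congr rfl fun g₂ _ => ?_
    rw [conjTranspose_smul, smul_mul_smul_comm, yor_conjTranspose, ← yor_mul, smul_smul]
    congr 1
    simp only [star_mul', star_div₀, star_one, star_natCast]
    ring

/-- Inactive rows are killed by `tau` on the left, inactive columns by the right invariance of the
third factor. -/
theorem spectrum_eq_zero (conv : Convention) (f : Perm (Fin n) ⧸ lastTwoStab n → Fin d → ℂ)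
    (a : Fin 7) (i : Fin 3 → Fin d) (k : Fin 4) {T U : StdTableau (shape hn k) n}
    (h : ¬ (T.IsActive ∧ U.IsActive)) : spectrum hn conv f a i k T U = 0 := by
  classical
  rw [spectrum, reducedEntry_eq_sum, tau_conjTranspose, tau_eq_diagonal, diagonal_mul]
  by_cases hT : T.IsActive
  · have hU : ¬ U.IsActive := fun hU => h ⟨hT, hU⟩
    rw [Matrix.sum_apply, Finset.sum_eq_zero, mul_zero]
    intro g _
    -- Substituting `g * g₂` for `g₂` leaves the representation at `g₂` alone, with a coefficient
    -- that is still right invariant.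
    rw [← Equiv.sum_comp (Equiv.mulLeft g)]
    simp only [coe_mulLeft, inv_mul_cancel_left]
    refine sum_smul_yor_apply_of_not_isActive (fun g₂ h hh => ?_) hU T
    rw [← mul_assoc, quotient_mk_mul _ hh]
  · rw [if_neg hT, zero_mul]

theorem spectrum_eq_pairFormula (conv : Convention)
    (f : Perm (Fin n) ⧸ lastTwoStab n → Fin d → ℂ) {M : Memory} (hM : HoldsInput hn f M)
    (a : Fin 7) (i : Fin 3 → Fin d) (k : Fin 4) {T U : StdTableau (shape hn k) n}
    (hT : T.IsActive) (hU : U.IsActive) : spectrum hn conv f a i k T U =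
      pairFormula (fun x y : Fin n => conv.val (maskedInput M (i 0) x y))
        (fun x y => conv.val (maskedInput M (i 1) x y)) (fun x y => maskedInput M (i 2) x y) a
        (typeWeight ((1 : Matrix (StdTableau (shape hn k) n) (StdTableau (shape hn k) n) ℂ) T U)
          (yorAdj (shape hn k) (lastAdj hn) T U) (T.content (pt hn 2)) (T.content (pt hn 3))) := by
  classical
  have hf : ∀ (σ : Perm (Fin n)) (j : Fin d),
      f σ j = maskedInput M j (σ (pt hn 2)) (σ (pt hn 3)) := by
    intro σ j
    rw [maskedInput, if_neg, hM]
    rw [Fin.val_inj]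
    exact fun h => pt_two_ne_pt_three hn (σ.injective h)
  have hz : ∀ (j : ℕ) (x : Fin n), maskedInput M j x x = 0 := fun j x => if_pos rfl
  have hcz : ∀ (j : ℕ) (x : Fin n), conv.val (maskedInput M j x x) = 0 := fun j x => by
    rw [hz]; cases conv <;> simp [Convention.val]
  rw [← sum_sum_mul_yor_apply hn (hcz _) (hcz _) (hz _) a hT hU, spectrum,
    reducedEntry_eq_sum, tau_conjTranspose, tau_eq_diagonal, diagonal_mul, if_pos hT, one_mul,
    Matrix.sum_apply]
  refine Finset.sum_congr rfl fun g _ => ?_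
  rw [Matrix.sum_apply]
  refine Finset.sum_congr rfl fun g₂ _ => ?_
  rw [Matrix.smul_apply, smul_eq_mul, hf, hf, hf]

end Main

end SkewSpectrum

end

theorem mainTheorem4 (conv : SkewSpectrum.Convention) :
    -- one program, with the claimed number of steps, computes every entry of the spectrum
    (∃ (P : SkewSpectrum.Prog) (C : ℕ), ∀ (n d : ℕ) (hn : 4 ≤ n), 1 ≤ d →
      ∀ (f : Equiv.Perm (Fin n) ⧸ SkewSpectrum.lastTwoStab n → Fin d → ℂ)
        (M : SkewSpectrum.Memory), SkewSpectrum.HoldsInput hn f M →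
        (P.run (SkewSpectrum.initEnv n d) M).2 ≤ C * (d ^ 2 * n ^ 3 + d ^ 3 * n ^ 2) ∧
        ∀ (a : Fin 7) (i : Fin 3 → Fin d) (k : Fin 4)
          (T U : SkewSpectrum.StdTableau (SkewSpectrum.shape hn k) n),
          (T.IsActive ∧ U.IsActive →
            (P.run (SkewSpectrum.initEnv n d) M).1 1 (SkewSpectrum.outputCell hn a i k T U) =
              SkewSpectrum.spectrum hn conv f a i k T U) ∧
          (¬ (T.IsActive ∧ U.IsActive) → SkewSpectrum.spectrum hn conv f a i k T U = 0)) ∧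
    -- the number of non-zero entries
    (∀ (n d : ℕ) (hn : 4 ≤ n)
      (f : Equiv.Perm (Fin n) ⧸ SkewSpectrum.lastTwoStab n → Fin d → ℂ),
      {x : Fin 7 × (Fin 3 → Fin d) × (Σ k : Fin 4,
          SkewSpectrum.StdTableau (SkewSpectrum.shape hn k) n ×
          SkewSpectrum.StdTableau (SkewSpectrum.shape hn k) n) |
        SkewSpectrum.spectrum hn conv f x.1 x.2.1 x.2.2.1 x.2.2.2.1 x.2.2.2.2 ≠ 0}.encard
        ≤ 49 * (d : ℕ∞) ^ 3) := by
  open SkewSpectrum in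
  constructor
  · obtain ⟨C, hC⟩ := exists_run_spectrumProg_le conv
    refine ⟨spectrumProg conv, C, fun n d hn hd f M hM => ⟨?_, fun a i k T U => ⟨?_, ?_⟩⟩⟩
    -- The program needs only the second term of the bound.
    · exact (hC n d (by omega) hd M).trans (Nat.mul_le_mul_left _ (Nat.le_add_left _ _))
    · rintro ⟨hT, hU⟩
      obtain ⟨q, e1, e2, e3, e4, e5⟩ := exists_pair hn hT hU
      rw [spectrum_eq_pairFormula hn conv f hM a i k hT hU, e2, e3, e4, e5,
        ← run_spectrumProg hn conv M a q (i 0).2 (i 1).2 (i 2).2, e1]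
      rfl
    · exact spectrum_eq_zero hn conv f a i k
  · intro n d hn f
    have hact : ∀ x : Fin 7 × (Fin 3 → Fin d) × (Σ k : Fin 4,
        StdTableau (shape hn k) n × StdTableau (shape hn k) n),
        spectrum hn conv f x.1 x.2.1 x.2.2.1 x.2.2.2.1 x.2.2.2.2 ≠ 0 →
        x.2.2.2.1.IsActive ∧ x.2.2.2.2.IsActive := fun x hx => by
      by_contra h
      exact hx (spectrum_eq_zero hn conv f x.1 x.2.1 x.2.2.1 h)
    -- Each non-zero entry is encoded by its group element, its orbit triple and the number of its
    -- pair of active tableaux. The address of the pair gives back the shape and the rows of the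
    -- last two letters, hence both tableaux, so the encoding into a set of `7 * d ^ 3 * 7` elements
    -- is injective.
    choose q hq using fun x : {x : Fin 7 × (Fin 3 → Fin d) × (Σ k : Fin 4,
        StdTableau (shape hn k) n × StdTableau (shape hn k) n) |
        spectrum hn conv f x.1 x.2.1 x.2.2.1 x.2.2.2.1 x.2.2.2.2 ≠ 0} =>
      exists_pair hn (hact x.1 x.2).1 (hact x.1 x.2).2
    have hinj : Function.Injective fun x => (x.1.1, x.1.2.1, q x) := by
      rintro ⟨⟨a, i, k, T, U⟩, hx⟩ ⟨⟨a', i', k', T', U'⟩, hx'⟩ h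
      simp only [Prod.mk.injEq] at h
      obtain ⟨rfl, rfl, h⟩ := h
      have h1 := (hq ⟨⟨a, i, k, T, U⟩, hx⟩).1
      have h2 := (hq ⟨⟨a, i, k', T', U'⟩, hx'⟩).1
      rw [h, h2] at h1
      simp only [List.cons.injEq, and_true] at h1
      obtain ⟨hk, r1, r2, r3, r4⟩ := h1
      obtain rfl := Fin.ext hk
      have hA := hact _ hx
      have hA' := hact _ hx'
      obtain rfl := hA'.1.eq_of_row hn hA.1 r1 r2
      obtain rfl := hA'.2.eq_of_row hn hA.2 r3 r4
      rfl
    refine (ENat.card_le_card_of_injective hinj).trans (le_of_eq ?_)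
    rw [ENat.card_eq_coe_fintype_card]
    simp only [Fintype.card_prod, Fintype.card_fun, Fintype.card_fin]
    push_cast
    ring
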